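/- Let $M$ be a smooth $n$-dimensional manifold with a smooth Riemannian metric $g$ and a smooth 1-form $\beta$; put $\alpha(x,y)=\sqrt{g_x(y,y)}$, $\|u\|_\alpha=\alpha(x,u)$, $b^2=\|\beta\|_\alpha^2$, $s=\beta/\alpha$, and let $X$ be the vector field with $g(X,\cdot)=\beta$. Let $0<b_0\le+\infty$, let $\phi=\phi(b^2,s)$ be a positive $C^\infty$ function on $\{|s|\le b<b_0\}$, suppose $\|\beta\|_\alpha<b_0$ on $M$, and suppose that $$F=\alpha\,\phi\!\left(b^2,\tfrac{\beta}{\alpha}\right)$$ is a Finsler metric on $M$ (a general $(\alpha,\beta)$-metric), i.e. $F$ is smooth off the zero section, positive on nonzero vectors, positively homogeneous of degree $1$, and its fundamental tensor $g^F_y(u,v)=\tfrac12\,\partial_\sigma\partial_\tau F^2(x,y+\sigma u+\tau v)|_{\sigma=\tau=0}$ is positive definite for $y\ne0$. Let $\phi_2,\phi_{22}$ denote the first and second derivatives of $\phi$ in its second variable. Suppose that $\beta$ is parallel with respect to $\alpha$, i.e. its covariant derivative for the Levi-Civita connection of $g$ vanishes. Let $x\in M$, let $y,u\in T_xM$ be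 linearly independent and $P=\operatorname{span}\{y,u\}$. Let $K^g(P)$ be the sectional curvature of $g$, and let $$K^F(y,P)=\frac{g^F_y(R_y(u),u)}{g^F_y(y,y)\,g^F_y(u,u)-g^F_y(y,u)^2}$$ be the flag curvature of $F$, where $R_y(u)=R^i{}_k u^k\,\partial_{x^i}$ is the Riemann curvature of $F$, given in local coordinates by $$R^i{}_k=2\frac{\partial G^i}{\partial x^k}-y^j\frac{\partial^2 G^i}{\partial x^j\partial y^k}+2G^j\frac{\partial^2 G^i}{\partial y^j\partial y^k}-\frac{\partial G^i}{\partial y^j}\frac{\partial G^j}{\partial y^k},\qquad G^i=\tfrac14 (g^F)^{il}\Big(\frac{\partial^2F^2}{\partial x^k\partial y^l}y^k-\frac{\partial F^2}{\partial x^l}\Big).$$ Then $$K^F(y,P)=\frac{\alpha^2\|u\|_\alpha^2-g(y,u)^2}{F^2\,g^F_y(u,u)-g^F_y(y,u)^2}\;\rho\;K^g(P),\qquad \rho=\phi(\phi-s\phi_2),$$ where $\alpha,F$ are evaluated at $(x,y)$ and $\phi,\phi_2$ at $(b^2(x),\beta(y)/\alpha(x,y))$. If moreover $\{y,u\}$ is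 orthonormal with respect to $g$, then $$K^F(y,P)=\frac{1}{\phi^2\left(1+g(X,u)^2D\right)}\,K^g(P),\qquad D=\frac{\phi_{22}}{\phi-s\phi_2},$$ where $D$ is read as $0$ if $\phi-s\phi_2=0$ at the point in question (this can happen only when $n=2$). -/

import Mathlib

open scoped Manifold ContDiff Bundle

noncomputable section

namespace FinslerGeometry

/-- The coordinate space `ℝⁿ`. -/
abbrev Coord (n : ℕ) : Type := EuclideanSpace ℝ (Fin n)

/-! ### Calculus on `ℝⁿ` and on `ℝⁿ × ℝⁿ` -/

section Coordinates

variable {n : ℕ}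

/-- The `i`-th standard basis vector of `ℝⁿ`. -/
def stdVec (i : Fin n) : Coord n := EuclideanSpace.single i (1 : ℝ)

/-- `∂f/∂xᵏ` for a function `f(x)`. -/
def pd (k : Fin n) (f : Coord n → ℝ) (x : Coord n) : ℝ := fderiv ℝ f x (stdVec k)

/-- `∂f/∂xᵏ` for a function `f(x, y)` of position `x` and velocity `y`. -/
def dx (k : Fin n) (f : Coord n → Coord n → ℝ) (x y : Coord n) : ℝ :=
  pd k (fun z => f z y) x

/-- `∂f/∂yᵏ` for a function `f(x, y)` of position `x` and velocity `y`. -/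
def dy (k : Fin n) (f : Coord n → Coord n → ℝ) (x y : Coord n) : ℝ :=
  pd k (f x) y

/-- The Hessian matrix `gᶠᵢⱼ(x, y) = ½ ∂²F²/∂yⁱ∂yʲ` of a Finsler function in coordinates. -/
def hessMatrix (F : Coord n → Coord n → ℝ) (x y : Coord n) : Matrix (Fin n) (Fin n) ℝ :=
  Matrix.of fun i j => (1 / 2) * dy i (dy j (fun z w => F z w ^ 2)) x y

/-- The spray coefficients
`Gⁱ = ¼ gᶠⁱˡ ( ∂²F²/∂xᵏ∂yˡ yᵏ - ∂F²/∂xˡ )` of a Finsler function in coordinates. -/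
def sprayCoeff (F : Coord n → Coord n → ℝ) (i : Fin n) (x y : Coord n) : ℝ :=
  (1 / 4) * ∑ l, (hessMatrix F x y)⁻¹ i l *
    ((∑ k, dx k (dy l (fun z w => F z w ^ 2)) x y * y k) - dx l (fun z w => F z w ^ 2) x y)

/-- The Riemann curvature of a Finsler function in coordinates,
`Rⁱₖ = 2 ∂Gⁱ/∂xᵏ - yʲ ∂²Gⁱ/∂xʲ∂yᵏ + 2 Gʲ ∂²Gⁱ/∂yʲ∂yᵏ - ∂Gⁱ/∂yʲ ∂Gʲ/∂yᵏ`. -/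
def riemannCoeff (F : Coord n → Coord n → ℝ) (i k : Fin n) (x y : Coord n) : ℝ :=
  2 * dx k (sprayCoeff F i) x y
    - (∑ j, y j * dx j (dy k (sprayCoeff F i)) x y)
    + 2 * (∑ j, sprayCoeff F j x y * dy j (dy k (sprayCoeff F i)) x y)
    - ∑ j, dy j (sprayCoeff F i) x y * dy k (sprayCoeff F j) x y

/-- The Christoffel symbols `Γⁱⱼₖ = ½ gⁱˡ (∂ⱼ gₗₖ + ∂ₖ gₗⱼ - ∂ₗ gⱼₖ)` of a matrix-valued function
`g` on `ℝⁿ`. -/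
def christoffel (g : Coord n → Matrix (Fin n) (Fin n) ℝ) (i j k : Fin n) (x : Coord n) : ℝ :=
  (1 / 2) * ∑ l, (g x)⁻¹ i l *
    (pd j (fun z => g z l k) x + pd k (fun z => g z l j) x - pd l (fun z => g z j k) x)

/-- The Riemann curvature tensor in coordinates,
`Rⁱⱼₖₗ = ∂ₖ Γⁱⱼₗ - ∂ₗ Γⁱⱼₖ + Γⁱₖₘ Γᵐⱼₗ - Γⁱₗₘ Γᵐⱼₖ`, so that `R(∂ₖ, ∂ₗ)∂ⱼ = Rⁱⱼₖₗ ∂ᵢ`. -/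
def curvTensor (g : Coord n → Matrix (Fin n) (Fin n) ℝ) (i j k l : Fin n) (x : Coord n) : ℝ :=
  pd k (christoffel g i j l) x - pd l (christoffel g i j k) x
    + (∑ m, christoffel g i k m x * christoffel g m j l x)
    - ∑ m, christoffel g i l m x * christoffel g m j k x

end Coordinates

/-! ### Metrics, forms and their coordinate expressions -/

section Manifold

variable {n : ℕ} {M : Type*} [TopologicalSpace M] [ChartedSpace (Coord n) M]

/-- The coordinates `(vⁱ)` of a tangent vector `v = vⁱ ∂/∂xⁱ` at `x` in the chart `e`. -/
def toCoord (e : OpenPartialHomeomorph M (Coord n)) (x : M) (v : TangentSpace (𝓡 n) x) :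
    Coord n :=
  mfderiv (𝓡 n) (𝓡 n) e x v

/-- The tangent vector `wⁱ ∂/∂xⁱ` at the point with coordinates `z` in the chart `e`. -/
def ofCoord (e : OpenPartialHomeomorph M (Coord n)) (z w : Coord n) :
    TangentSpace (𝓡 n) (e.symm z) :=
  mfderiv (𝓡 n) (𝓡 n) e.symm z w

/-- The tangent vector `wⁱ ∂/∂xⁱ` at the point `x` in the domain of the chart `e`
(the inverse of `toCoord e x`). -/
def vecOfCoord (e : OpenPartialHomeomorph M (Coord n)) (x : M) (w : Coord n) :
    TangentSpace (𝓡 n) x :=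
  (mfderiv (𝓡 n) (𝓡 n) e x).inverse w

/-- The coordinate expression `F(x, y) = F(yⁱ ∂/∂xⁱ|ₓ)` of a function on the tangent bundle. -/
def coordFn (e : OpenPartialHomeomorph M (Coord n)) (F : TangentBundle (𝓡 n) M → ℝ)
    (z w : Coord n) : ℝ :=
  F ⟨e.symm z, ofCoord e z w⟩

/-- The fundamental tensor `gᶠ_y(u, v) = ½ ∂²/∂s∂t F²(y + s u + t v) |_{s = t = 0}`. -/
def fundTensor (F : TangentBundle (𝓡 n) M → ℝ) (x : M) (y u v : TangentSpace (𝓡 n) x) : ℝ :=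
  (1 / 2) * deriv (fun s : ℝ => deriv (fun t : ℝ => F ⟨x, y + s • u + t • v⟩ ^ 2) 0) 0

/-- The Riemann curvature operator `R_y(u) = Rⁱₖ(x, y) uᵏ ∂/∂xⁱ` of a Finsler metric, computed in
the chart `e`. -/
def finslerCurvOp (e : OpenPartialHomeomorph M (Coord n)) (F : TangentBundle (𝓡 n) M → ℝ)
    (x : M) (y u : TangentSpace (𝓡 n) x) : TangentSpace (𝓡 n) x :=
  vecOfCoord e x (∑ i, (∑ k, riemannCoeff (coordFn e F) i k (e x) (toCoord e x y) *
    toCoord e x u k) • stdVec i)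

/-- The flag curvature `K^F(y, P)` of the flag with flagpole `y` and plane `P = span {y, u}`,
computed in the chart `e`. -/
def flagCurvature (e : OpenPartialHomeomorph M (Coord n)) (F : TangentBundle (𝓡 n) M → ℝ)
    (x : M) (y u : TangentSpace (𝓡 n) x) : ℝ :=
  fundTensor F x y (finslerCurvOp e F x y u) u /
    (fundTensor F x y y y * fundTensor F x y u u - fundTensor F x y y u ^ 2)

variable [IsManifold (𝓡 n) ∞ M]

variable (n M) in
/-- Smooth Riemannian metrics on `M`. -/
abbrev RiemMetric : Type _ :=
  Bundle.ContMDiffRiemannianMetric (𝓡 n) ∞ (Coord n) (fun x : M => TangentSpace (𝓡 n) x)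

variable (n M) in
/-- Smooth 1-forms on `M`. -/
abbrev OneForm : Type _ :=
  Cₛ^∞⟮𝓡 n; Coord n →L[ℝ] ℝ, fun x : M => TangentSpace (𝓡 n) x →L[ℝ] ℝ⟯

/-- The coordinate matrix `gᵢⱼ` of a Riemannian metric in the chart `e`. -/
def metricMatrix (e : OpenPartialHomeomorph M (Coord n)) (g : RiemMetric n M) (z : Coord n) :
    Matrix (Fin n) (Fin n) ℝ :=
  Matrix.of fun i j => g.inner (e.symm z) (ofCoord e z (stdVec i)) (ofCoord e z (stdVec j))

/-- The components `bᵢ` of a 1-form in the chart `e`. -/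
def formCoeff (e : OpenPartialHomeomorph M (Coord n)) (β : OneForm n M) (i : Fin n)
    (z : Coord n) : ℝ :=
  β (e.symm z) (ofCoord e z (stdVec i))

/-- `β` is parallel with respect to the Levi-Civita connection of `g`: its covariant derivative
`b_{i;j} = ∂ⱼ bᵢ - Γᵏᵢⱼ bₖ` vanishes in all local coordinates. -/
def IsParallel (g : RiemMetric n M) (β : OneForm n M) : Prop :=
  ∀ e ∈ IsManifold.maximalAtlas (𝓡 n) ∞ M, ∀ z ∈ e.target, ∀ i j : Fin n,
    pd j (formCoeff e β i) z
      - ∑ k, christoffel (metricMatrix e g) k i j z * formCoeff e β k z = 0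

/-- The vector `R(u, v)w` for the curvature tensor `R` of `g`, computed in the chart `e`. -/
def riemCurvOp (e : OpenPartialHomeomorph M (Coord n)) (g : RiemMetric n M)
    (x : M) (u v w : TangentSpace (𝓡 n) x) : TangentSpace (𝓡 n) x :=
  vecOfCoord e x (∑ i, (∑ j, ∑ k, ∑ l, curvTensor (metricMatrix e g) i j k l (e x) *
    toCoord e x w j * toCoord e x u k * toCoord e x v l) • stdVec i)

/-- The sectional curvature `K^g(P)` of the plane `P = span {y, u}`, computed in the chart `e`. -/
def sectionalCurvature (e : OpenPartialHomeomorph M (Coord n)) (g : RiemMetric n M)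
    (x : M) (y u : TangentSpace (𝓡 n) x) : ℝ :=
  g.inner x (riemCurvOp e g x u y y) u /
    (g.inner x y y * g.inner x u u - g.inner x y u ^ 2)

/-- Every covector is represented by a tangent vector through the Riemannian metric. -/
theorem exists_dual_vector (g : RiemMetric n M) (β : OneForm n M) (x : M) :
    ∃ X : TangentSpace (𝓡 n) x, ∀ v, g.inner x X v = β x v := by
  have : FiniteDimensional ℝ (TangentSpace (𝓡 n) x) :=
    inferInstanceAs (FiniteDimensional ℝ (Coord n))
  let L : TangentSpace (𝓡 n) x →ₗ[ℝ] Module.Dual ℝ (TangentSpace (𝓡 n) x) :=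
    { toFun := fun X => (g.inner x X).toLinearMap
      map_add' := fun X Y => by ext v; simp
      map_smul' := fun c X => by ext v; simp }
  have hinj : Function.Injective L := by
    rw [injective_iff_map_eq_zero]
    intro X hX
    by_contra hne
    have h1 := g.pos x X hne
    have h2 : g.inner x X X = 0 := LinearMap.congr_fun hX X
    linarith
  have hsurj : Function.Surjective L :=
    (LinearMap.injective_iff_surjective_of_finrank_eq_finrank
      (Subspace.dual_finrank_eq (K := ℝ) (V := TangentSpace (𝓡 n) x)).symm).1 hinj
  obtain ⟨X, hX⟩ := hsurj (β x).toLinearMap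
  exact ⟨X, fun v => LinearMap.congr_fun hX v⟩

/-- The vector field `X` corresponding to the 1-form `β` through `g`, i.e. `g(X, v) = β(v)`. -/
def sharp (g : RiemMetric n M) (β : OneForm n M) (x : M) : TangentSpace (𝓡 n) x :=
  Classical.choose (exists_dual_vector g β x)

theorem inner_sharp (g : RiemMetric n M) (β : OneForm n M) (x : M) (v : TangentSpace (𝓡 n) x) :
    g.inner x (sharp g β x) v = β x v :=
  Classical.choose_spec (exists_dual_vector g β x) v

/-- `b² = ‖β‖²_α`, the squared norm of the 1-form `β` with respect to `g`. -/
def normSq (g : RiemMetric n M) (β : OneForm n M) (x : M) : ℝ :=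
  g.inner x (sharp g β x) (sharp g β x)

/-- `α(x, y) = √(g(y, y))`. -/
def alpha (g : RiemMetric n M) (x : M) (y : TangentSpace (𝓡 n) x) : ℝ := √(g.inner x y y)

/-- `F` is a Finsler metric: smooth off the zero section, positive on nonzero vectors, positively
homogeneous of degree one, and with positive definite fundamental tensor. -/
structure IsFinsler (F : TangentBundle (𝓡 n) M → ℝ) : Prop where
  smooth : ContMDiffOn (𝓡 n).tangent 𝓘(ℝ, ℝ) ∞ F {v | v.2 ≠ 0}
  pos : ∀ (x : M) (y : TangentSpace (𝓡 n) x), y ≠ 0 → 0 < F ⟨x, y⟩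
  homog : ∀ (x : M) (y : TangentSpace (𝓡 n) x) (c : ℝ), 0 ≤ c → F ⟨x, c • y⟩ = c * F ⟨x, y⟩
  convex : ∀ (x : M) (y u : TangentSpace (𝓡 n) x), y ≠ 0 → u ≠ 0 → 0 < fundTensor F x y u u

/-- The set of `(b², s)` with `|s| ≤ b < b₀`, where `0 ≤ b` and `b₀` may be `+∞`. -/
def phiDomain (b₀ : EReal) : Set (ℝ × ℝ) :=
  {p | 0 ≤ p.1 ∧ |p.2| ≤ √p.1 ∧ ((√p.1 : ℝ) : EReal) < b₀}

/-- `F = α φ(b², β/α)` is a general `(α, β)`-metric: `F` is a Finsler metric, `φ(b², s)` is a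
positive smooth function for `|s| ≤ b < b₀` (smooth in the usual sense on a set that is not open:
near each of its points), and `‖β‖_α < b₀` everywhere. -/
structure IsGeneralAlphaBeta (F : TangentBundle (𝓡 n) M → ℝ) (g : RiemMetric n M)
    (β : OneForm n M) (b₀ : EReal) (φ : ℝ → ℝ → ℝ) : Prop where
  finsler : IsFinsler F
  b₀_pos : 0 < b₀
  phi_smooth : ∀ p ∈ phiDomain b₀, ContDiffAt ℝ ∞ (fun q : ℝ × ℝ => φ q.1 q.2) p
  phi_pos : ∀ p ∈ phiDomain b₀, 0 < φ p.1 p.2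
  norm_lt : ∀ x : M, ((√(normSq g β x) : ℝ) : EReal) < b₀
  eq : ∀ (x : M) (y : TangentSpace (𝓡 n) x),
    F ⟨x, y⟩ = alpha g x y * φ (normSq g β x) (β x y / alpha g x y)

end Manifold

/-- `φ₂(t, s) = ∂φ/∂s`. -/
def phi2 (φ : ℝ → ℝ → ℝ) (t s : ℝ) : ℝ := deriv (φ t) s

/-- `φ₂₂(t, s) = ∂²φ/∂s²`. -/
def phi22 (φ : ℝ → ℝ → ℝ) (t s : ℝ) : ℝ := deriv (phi2 φ t) s

end FinslerGeometry

end

/-!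
Fix a chart with coordinates `(z, w)` on the tangent bundle, and let `Γ` be the Christoffel symbols
of `g`. Call a function of `(z, w)` *horizontally constant* if it is annihilated by the horizontal
lifts `∂/∂xᵏ - Γⁱₖⱼ yʲ ∂/∂yⁱ` (`horizLift`). The energy `g(w, w)` is horizontally constant because
the Levi-Civita connection is metric, `β(w)` is because `β` is parallel, and `b²` is because a
parallel form has constant norm (`fderiv_normSq_eq_zero`). As `F²` is a smooth function of these
three, it is horizontally constant as well.

Two consequences of horizontal constancy carry the argument.

* Differentiating it in `y` shows that the spray of `F` is the geodesic spray of `g`,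
  `Gⁱ = ½ Γⁱⱼₖ yʲ yᵏ` (`sprayCoeff_eq_of_horizontal`; the Hessian is invertible by strong
  convexity). Hence `R_y(u) = R(u, y)y`, the curvature of `g`
  (`IsGeneralAlphaBeta.finslerCurvOp_eq`).
* Commuting two horizontal lifts gives the Ricci identity (`fderiv_curvTensor_eq_zero`): the
  vertical vectors `R(∂ₖ, ∂ₗ)y` annihilate horizontally constant functions. For the energy and for
  `β` this says `g(y, R(u, y)y) = 0` and `β(R(u, y)y) = 0` (`riemCurvOp_orthogonal`).

In the explicit formula for the fundamental tensor (`IsGeneralAlphaBeta.fundTensor_eq`) every term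
of `g^F_y(R_y(u), u)` except `ρ g(R_y(u), u)` therefore vanishes, which gives the first formula. The
second follows by evaluating the denominator on an orthonormal pair. When `φ - s φ₂ = 0` the same
formula gives `g^F_y(R_y(u), R_y(u)) = 0`, so `R_y(u) = 0` and both sides vanish.
-/

noncomputable section

namespace FinslerGeometry

/-! ### Partial derivatives on `ℝⁿ × ℝⁿ` -/

section CoordinateCalculus

variable {n : ℕ}

theorem coord_eq_sum (w : Coord n) : w = ∑ i, w i • stdVec i := by
  ext k
  simp [stdVec, Pi.single_apply]

theorem sum_smul_stdVec_apply (c : Fin n → ℝ) (k : Fin n) :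
    (∑ i, c i • stdVec i : Coord n) k = c k := by
  simp [stdVec, Pi.single_apply]

theorem dx_eq_fderiv {f : Coord n → Coord n → ℝ} {z w : Coord n} (k : Fin n)
    (hf : DifferentiableAt ℝ (Function.uncurry f) (z, w)) :
    dx k f z w = fderiv ℝ (Function.uncurry f) (z, w) (stdVec k, 0) := by
  have h : HasFDerivAt (fun z' => f z' w)
      ((fderiv ℝ (Function.uncurry f) (z, w)).comp (ContinuousLinearMap.inl ℝ (Coord n) (Coord n)))
      z :=
    HasFDerivAt.comp (g := Function.uncurry f) (f := fun z' => (z', w)) z hf.hasFDerivAt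
      (hasFDerivAt_prodMk_left z w)
  simp [dx, pd, h.fderiv]

theorem dy_eq_fderiv {f : Coord n → Coord n → ℝ} {z w : Coord n} (k : Fin n)
    (hf : DifferentiableAt ℝ (Function.uncurry f) (z, w)) :
    dy k f z w = fderiv ℝ (Function.uncurry f) (z, w) (0, stdVec k) := by
  have h : HasFDerivAt (fun w' => f z w')
      ((fderiv ℝ (Function.uncurry f) (z, w)).comp (ContinuousLinearMap.inr ℝ (Coord n) (Coord n)))
      w :=
    HasFDerivAt.comp (g := Function.uncurry f) w hf.hasFDerivAt (hasFDerivAt_prodMk_right z w)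
  have h' : fderiv ℝ (f z) w = _ := h.fderiv
  simp [dy, pd, h']

theorem eventually_differentiableAt {E : Type*} [NormedAddCommGroup E] [NormedSpace ℝ E]
    {f : E → ℝ} {p : E} (hf : ContDiffAt ℝ 2 f p) : ∀ᶠ q in nhds p, DifferentiableAt ℝ f q := by
  filter_upwards [hf.eventually (by simp)] with q hq
  exact hq.differentiableAt (by simp)

theorem differentiableAt_fderiv {E : Type*} [NormedAddCommGroup E] [NormedSpace ℝ E]
    {f : E → ℝ} {p : E} (hf : ContDiffAt ℝ 2 f p) : DifferentiableAt ℝ (fderiv ℝ f) p :=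
  (hf.fderiv_right (m := 1) (by norm_num)).differentiableAt (by simp)

/-- The `y`-derivative `dy l f` agrees near `p` with the total derivative in the direction
`(0, ∂ₗ)`, which is differentiable. -/
theorem hasFDerivAt_dy {f : Coord n → Coord n → ℝ} {p : Coord n × Coord n} (l : Fin n)
    (hf : ContDiffAt ℝ 2 (Function.uncurry f) p) :
    HasFDerivAt (Function.uncurry (dy l f))
      ((fderiv ℝ (fderiv ℝ (Function.uncurry f)) p).flip (0, stdVec l)) p := by
  have h := (differentiableAt_fderiv hf).hasFDerivAt.clm_apply
    (hasFDerivAt_const ((0 : Coord n), (stdVec l : Coord n)) p)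
  refine (h.congr_of_eventuallyEq ?_).congr_fderiv (by ext <;> simp)
  filter_upwards [eventually_differentiableAt hf] with q hq
  exact dy_eq_fderiv l hq

theorem dx_dy_eq_fderiv {f : Coord n → Coord n → ℝ} {z w : Coord n} (k l : Fin n)
    (hf : ContDiffAt ℝ 2 (Function.uncurry f) (z, w)) :
    dx k (dy l f) z w
      = fderiv ℝ (fderiv ℝ (Function.uncurry f)) (z, w) (stdVec k, 0) (0, stdVec l) := by
  have h := hasFDerivAt_dy l hf
  rw [dx_eq_fderiv k h.differentiableAt, h.fderiv, ContinuousLinearMap.flip_apply]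

theorem dy_dy_eq_fderiv {f : Coord n → Coord n → ℝ} {z w : Coord n} (k l : Fin n)
    (hf : ContDiffAt ℝ 2 (Function.uncurry f) (z, w)) :
    dy k (dy l f) z w
      = fderiv ℝ (fderiv ℝ (Function.uncurry f)) (z, w) (0, stdVec k) (0, stdVec l) := by
  have h := hasFDerivAt_dy l hf
  rw [dy_eq_fderiv k h.differentiableAt, h.fderiv, ContinuousLinearMap.flip_apply]

theorem fderiv_inr_sum {f : Coord n × Coord n → ℝ} (p : Coord n × Coord n) (c : Fin n → ℝ) :
    fderiv ℝ f p (0, ∑ i, c i • stdVec i) = ∑ i, c i * fderiv ℝ f p (0, stdVec i) := by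
  have h : ∀ v, fderiv ℝ f p (0, v)
      = (fderiv ℝ f p).comp (ContinuousLinearMap.inr ℝ (Coord n) (Coord n)) v := fun v => rfl
  simp only [h, map_sum, map_smul, smul_eq_mul]

end CoordinateCalculus

/-! ### Horizontal lifts -/

section HorizontalLift

variable {n : ℕ}

/-- The horizontal lift `∂/∂xᵏ - Γⁱₖⱼ yʲ ∂/∂yⁱ` of a coordinate vector field for connection
coefficients `Γ`, as a vector field on `ℝⁿ × ℝⁿ`. -/
def horizLift (Γ : Fin n → Fin n → Fin n → Coord n → ℝ) (k : Fin n) (p : Coord n × Coord n) :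
    Coord n × Coord n :=
  (stdVec k, -∑ i, (∑ j, Γ i k j p.1 * p.2 j) • stdVec i)

theorem fderiv_horizLift (Γ : Fin n → Fin n → Fin n → Coord n → ℝ) (k : Fin n)
    (f : Coord n × Coord n → ℝ) (p q : Coord n × Coord n) :
    fderiv ℝ f p (horizLift Γ k q) = fderiv ℝ f p (stdVec k, 0)
      - ∑ i, (∑ j, Γ i k j q.1 * q.2 j) * fderiv ℝ f p (0, stdVec i) := by
  rw [← fderiv_inr_sum, ← map_sub]
  simp [horizLift]

theorem hasDerivAt_horizLift {Γ : Fin n → Fin n → Fin n → Coord n → ℝ} {k : Fin n}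
    {p v : Coord n × Coord n} {Γ' : Fin n → Fin n → ℝ}
    (hΓ : ∀ i j, HasDerivAt (fun t : ℝ => Γ i k j (p.1 + t • v.1)) (Γ' i j) 0) :
    HasDerivAt (fun t : ℝ => horizLift Γ k (p + t • v))
      (0, -∑ i, (∑ j, (Γ' i j * p.2 j + Γ i k j p.1 * v.2 j)) • stdVec i) 0 := by
  refine (hasDerivAt_const _ _).prodMk (HasDerivAt.fun_neg (HasDerivAt.fun_sum fun i _ =>
    HasDerivAt.smul_const (HasDerivAt.fun_sum fun j _ => ?_) _))
  have h2 : HasDerivAt (fun t : ℝ => (p.2 + t • v.2) j) (v.2 j) 0 := by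
    simpa using ((hasDerivAt_id (0 : ℝ)).mul_const (v.2 j)).const_add (p.2 j)
  have h3 := (hΓ i j).fun_mul h2
  simp only [zero_smul, add_zero] at h3
  exact h3

/-- If `df(V) = 0` near `p` for a vector field `V`, then differentiating this identity in the
direction `v` gives `d²f(v, V) + df(∂ᵥV) = 0` at `p`. -/
theorem fderiv_fderiv_add_eq_zero {E : Type*} [NormedAddCommGroup E] [NormedSpace ℝ E]
    {f : E → ℝ} {V : E → E} {p v V' : E} (hf : ContDiffAt ℝ 2 f p)
    (h0 : ∀ᶠ q in nhds p, fderiv ℝ f q (V q) = 0)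
    (hV : HasDerivAt (fun t : ℝ => V (p + t • v)) V' 0) :
    fderiv ℝ (fderiv ℝ f) p v (V p) + fderiv ℝ f p V' = 0 := by
  have hc : HasDerivAt (fun t : ℝ => p + t • v) v 0 := by
    simpa using ((hasDerivAt_id (0 : ℝ)).smul_const v).const_add p
  have hp : p + (0 : ℝ) • v = p := by simp
  have hD : HasDerivAt (fun t : ℝ => fderiv ℝ f (p + t • v)) (fderiv ℝ (fderiv ℝ f) p v) 0 := by
    have h := (differentiableAt_fderiv hf).hasFDerivAt
    rw [← hp] at h
    have h' := HasFDerivAt.comp_hasDerivAt (f := fun t : ℝ => p + t • v) 0 h hc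
    rwa [hp] at h'
  have h1 := hD.clm_apply hV
  have h2 : (fun t : ℝ => fderiv ℝ f (p + t • v) (V (p + t • v))) =ᶠ[nhds 0] fun _ => 0 := by
    have ht : Filter.Tendsto (fun t : ℝ => p + t • v) (nhds 0) (nhds p) := by
      simpa using hc.continuousAt.tendsto
    exact ht.eventually h0
  have h3 := (h1.congr_of_eventuallyEq h2.symm).unique (hasDerivAt_const (0 : ℝ) (0 : ℝ))
  simpa using h3

end HorizontalLift

/-! ### The spray of a horizontally constant Finsler function -/

section Spray

variable {n : ℕ}

/-- If `F²` is constant along horizontal lifts of a torsion-free connection, the spray of `F` is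
the geodesic spray of that connection. -/
theorem sprayCoeff_eq_of_horizontal {Γ : Fin n → Fin n → Fin n → Coord n → ℝ}
    {f : Coord n → Coord n → ℝ} {z w : Coord n}
    (hΓ : ∀ i j k, Γ i j k z = Γ i k j z)
    (hf : ContDiffAt ℝ 2 (Function.uncurry fun z w => f z w ^ 2) (z, w))
    (h0 : ∀ᶠ q in nhds (z, w), ∀ k,
      fderiv ℝ (Function.uncurry fun z w => f z w ^ 2) q (horizLift Γ k q) = 0)
    (hdet : IsUnit (hessMatrix f z w).det) (i : Fin n) :
    sprayCoeff f i z w = (1 / 2) * ∑ j, ∑ k, Γ i j k z * w j * w k := by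
  set L := Function.uncurry fun z w => f z w ^ 2 with hL
  set D1 := fderiv ℝ L (z, w) with hD1
  set D2 := fderiv ℝ (fderiv ℝ L) (z, w) with hD2
  have hsymm : ∀ a b, D2 a b = D2 b a := fun a b =>
    (hf.isSymmSndFDerivAt (by simp)) a b
  -- `D2 (0, eₗ) (0, ·)` on a sum of basis vectors
  have hD2sum : ∀ (a : Coord n × Coord n) (c : Fin n → ℝ),
      D2 a (0, ∑ i, c i • stdVec i) = ∑ i, c i * D2 a (0, stdVec i) := fun a c => by
    have h : ∀ v, D2 a (0, v)
      = (D2 a).comp (ContinuousLinearMap.inr ℝ (Coord n) (Coord n)) v := fun v => rfl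
    simp only [h, map_sum, map_smul, smul_eq_mul]
  -- horizontal constancy differentiated in the direction `∂/∂yˡ`
  have hvert : ∀ k l, D2 (0, stdVec l) (stdVec k, 0)
      = ∑ i, (∑ j, Γ i k j z * w j) * D2 (0, stdVec l) (0, stdVec i)
        + ∑ i, Γ i k l z * D1 (0, stdVec i) := fun k l => by
    have h := fderiv_fderiv_add_eq_zero (v := (0, stdVec l)) hf (h0.mono fun q hq => hq k)
      (hasDerivAt_horizLift (Γ' := fun _ _ => 0) fun i j => by
        simpa using hasDerivAt_const (0 : ℝ) (Γ i k j z))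
    have h1 : ((0 : Coord n), -∑ i, (∑ j, ((0 : ℝ) * w j + Γ i k j z * (stdVec l : Coord n) j))
        • (stdVec i : Coord n)) = -((0 : Coord n), ∑ i, Γ i k l z • (stdVec i : Coord n)) := by
      simp [stdVec]
    rw [h1, map_neg, fderiv_inr_sum] at h
    have h2 : horizLift Γ k (z, w) = (stdVec k, 0)
        - (0, ∑ i, (∑ j, Γ i k j z * w j) • stdVec i) := by simp [horizLift]
    rw [h2, map_sub, hD2sum] at h
    linarith
  have hhor : ∀ l, D1 (stdVec l, 0) = ∑ i, (∑ j, Γ i l j z * w j) * D1 (0, stdVec i) :=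
    fun l => by
    have h := h0.self_of_nhds l
    rw [fderiv_horizLift] at h
    linarith
  -- the bracket in the definition of the spray coefficients
  have hbr : ∀ l, (∑ k, dx k (dy l (fun z w => f z w ^ 2)) z w * w k)
      - dx l (fun z w => f z w ^ 2) z w
      = 2 * ∑ m, hessMatrix f z w l m * ∑ j, ∑ k, Γ m j k z * w j * w k := fun l => by
    rw [dx_eq_fderiv l (hf.differentiableAt (by simp)), ← hL, ← hD1, hhor]
    have h1 : ∀ k, dx k (dy l (fun z w => f z w ^ 2)) z w * w k
        = ∑ i, (∑ j, Γ i k j z * w k * w j) * D2 (0, stdVec l) (0, stdVec i)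
          + ∑ i, Γ i l k z * w k * D1 (0, stdVec i) := fun k => by
      rw [dx_dy_eq_fderiv k l hf, ← hL, ← hD2, hsymm, hvert, add_mul, Finset.sum_mul,
        Finset.sum_mul]
      congr 1
      · refine Finset.sum_congr rfl fun i _ => ?_
        simp only [Finset.sum_mul]
        exact Finset.sum_congr rfl fun j _ => by ring
      · refine Finset.sum_congr rfl fun i _ => ?_
        rw [hΓ i k l]; ring
    have h2 : ∀ m, hessMatrix f z w l m = 1 / 2 * D2 (0, stdVec l) (0, stdVec m) := fun m => by
      rw [hessMatrix, Matrix.of_apply, dy_dy_eq_fderiv l m hf]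
    simp only [h1, h2, Finset.sum_add_distrib]
    rw [Finset.sum_comm, Finset.sum_comm (f := fun k i => Γ i l k z * w k * D1 (0, stdVec i))]
    simp only [Finset.sum_mul, Finset.mul_sum]
    rw [add_sub_cancel_right]
    refine Finset.sum_congr rfl fun m _ => Finset.sum_congr rfl fun j _ =>
      Finset.sum_congr rfl fun k _ => ?_
    ring
  simp only [sprayCoeff, hbr]
  have hinv : ∀ S : Fin n → ℝ,
      ∑ l, (hessMatrix f z w)⁻¹ i l * (2 * ∑ m, hessMatrix f z w l m * S m) = 2 * S i := by
    intro S
    have h : ((hessMatrix f z w)⁻¹).mulVec ((hessMatrix f z w).mulVec S) = S := by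
      rw [Matrix.mulVec_mulVec, Matrix.nonsing_inv_mul _ hdet, Matrix.one_mulVec]
    have h' := congrFun h i
    simp only [Matrix.mulVec, dotProduct] at h'
    rw [← h', Finset.mul_sum]
    exact Finset.sum_congr rfl fun l _ => by ring
  rw [hinv]
  ring

end Spray

/-! ### Christoffel symbols -/

section ChristoffelSymbols

variable {n : ℕ}

theorem christoffel_symm {G : Coord n → Matrix (Fin n) (Fin n) ℝ} (hG : ∀ z i j, G z i j = G z j i)
    (i j k : Fin n) (z : Coord n) : christoffel G i j k z = christoffel G i k j z := by
  unfold christoffel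
  congr 1
  refine Finset.sum_congr rfl fun l _ => ?_
  have : (fun z => G z j k) = fun z => G z k j := funext fun z => hG z j k
  rw [this]
  ring

theorem sum_mul_christoffel {G : Coord n → Matrix (Fin n) (Fin n) ℝ} {z : Coord n}
    (hdet : IsUnit (G z).det) (i j k : Fin n) :
    ∑ m, G z i m * christoffel G m j k z
      = (1 / 2) * (pd j (fun z => G z i k) z + pd k (fun z => G z i j) z
        - pd i (fun z => G z j k) z) := by
  have h : ∀ S : Fin n → ℝ, ∑ m, G z i m * (1 / 2 * ∑ l, (G z)⁻¹ m l * S l) = 1 / 2 * S i := by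
    intro S
    have h : (G z).mulVec (((G z)⁻¹).mulVec S) = S := by
      rw [Matrix.mulVec_mulVec, Matrix.mul_nonsing_inv _ hdet, Matrix.one_mulVec]
    have h' := congrFun h i
    simp only [Matrix.mulVec, dotProduct] at h'
    rw [← h', Finset.mul_sum]
    exact Finset.sum_congr rfl fun l _ => by ring
  exact h _

/-- The Levi-Civita connection is metric. -/
theorem pd_metric {G : Coord n → Matrix (Fin n) (Fin n) ℝ} (hG : ∀ z i j, G z i j = G z j i)
    {z : Coord n} (hdet : IsUnit (G z).det) (i j k : Fin n) :
    pd k (fun z => G z i j) z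
      = ∑ m, G z j m * christoffel G m k i z + ∑ m, G z i m * christoffel G m k j z := by
  rw [sum_mul_christoffel hdet, sum_mul_christoffel hdet]
  have h : ∀ a b, (fun z => G z a b) = fun z => G z b a := fun a b => funext fun z => hG z a b
  rw [h j i, h k i, h k j]
  ring

theorem contDiffAt_det {m : ℕ} {E : Type*} [NormedAddCommGroup E] [NormedSpace ℝ E]
    {A : E → Matrix (Fin m) (Fin m) ℝ} {z : E}
    (hA : ∀ i j, ContDiffAt ℝ ∞ (fun z => A z i j) z) :
    ContDiffAt ℝ ∞ (fun z => (A z).det) z := by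
  simp only [Matrix.det_apply']
  exact ContDiffAt.sum fun σ _ => contDiffAt_const.mul (contDiffAt_prod fun i _ => hA _ _)

theorem contDiffAt_inv_apply {m : ℕ} {E : Type*} [NormedAddCommGroup E] [NormedSpace ℝ E]
    {A : E → Matrix (Fin m) (Fin m) ℝ} {z : E}
    (hA : ∀ i j, ContDiffAt ℝ ∞ (fun z => A z i j) z) (hdet : IsUnit (A z).det) (i j : Fin m) :
    ContDiffAt ℝ ∞ (fun z => (A z)⁻¹ i j) z := by
  simp only [Matrix.inv_def, Matrix.smul_apply, Ring.inverse_eq_inv', smul_eq_mul]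
  refine ((contDiffAt_det hA).inv hdet.ne_zero).mul ?_
  simp only [Matrix.adjugate_apply]
  refine contDiffAt_det fun a b => ?_
  by_cases h : a = j
  · subst h; simp only [Matrix.updateRow_self]; exact contDiffAt_const
  · simp only [Matrix.updateRow_ne h]; exact hA a b

theorem contDiffAt_pd {f : Coord n → ℝ} {z : Coord n} (k : Fin n) (hf : ContDiffAt ℝ ∞ f z) :
    ContDiffAt ℝ ∞ (pd k f) z :=
  (hf.fderiv_right (m := ∞) (by simp)).clm_apply contDiffAt_const

theorem contDiffAt_christoffel {G : Coord n → Matrix (Fin n) (Fin n) ℝ} {z : Coord n}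
    (hG : ∀ i j, ContDiffAt ℝ ∞ (fun z => G z i j) z) (hdet : IsUnit (G z).det) (i j k : Fin n) :
    ContDiffAt ℝ ∞ (christoffel G i j k) z :=
  contDiffAt_const.mul (ContDiffAt.sum fun l _ => (contDiffAt_inv_apply hG hdet i l).mul
    (((contDiffAt_pd j (hG l k)).add (contDiffAt_pd k (hG l j))).sub (contDiffAt_pd l (hG j k))))

end ChristoffelSymbols

/-! ### Curvature and horizontally constant functions -/

section Curvature

variable {n : ℕ}

/-- A horizontally constant function is annihilated by the curvature: commuting the horizontal
lifts of `∂ₖ` and `∂ₗ` produces the vertical vector `Rⁱⱼₖₗ yʲ ∂/∂yⁱ`. -/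
theorem fderiv_curvTensor_eq_zero {G : Coord n → Matrix (Fin n) (Fin n) ℝ}
    {f : Coord n × Coord n → ℝ} {p : Coord n × Coord n}
    (hΓ : ∀ i j k, DifferentiableAt ℝ (christoffel G i j k) p.1)
    (hG : ∀ z i j, G z i j = G z j i)
    (hf : ContDiffAt ℝ 2 f p)
    (h0 : ∀ᶠ q in nhds p, ∀ k, fderiv ℝ f q (horizLift (christoffel G) k q) = 0) (k l : Fin n) :
    ∑ i, (∑ j, curvTensor G i j k l p.1 * p.2 j) * fderiv ℝ f p (0, stdVec i) = 0 := by
  -- horizontal constancy along the lift of `∂ₖ`, differentiated along the lift of `∂ₗ`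
  have key : ∀ k l, fderiv ℝ (fderiv ℝ f) p (horizLift (christoffel G) l p)
      (horizLift (christoffel G) k p)
      = ∑ i, (∑ j, (pd l (christoffel G i k j) p.1 * p.2 j
        - christoffel G i k j p.1 * ∑ m, christoffel G j l m p.1 * p.2 m))
        * fderiv ℝ f p (0, stdVec i) := fun k l => by
    have h := fderiv_fderiv_add_eq_zero (v := horizLift (christoffel G) l p) hf
      (h0.mono fun q hq => hq k)
      (hasDerivAt_horizLift (Γ' := fun i j => pd l (christoffel G i k j) p.1) fun i j => by
        have h1 : HasDerivAt (fun t : ℝ => p.1 + t • (stdVec l : Coord n)) (stdVec l) 0 := by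
          simpa using ((hasDerivAt_id (0 : ℝ)).smul_const (stdVec l : Coord n)).const_add p.1
        have h2 := (hΓ i k j).hasFDerivAt
        rw [show p.1 = p.1 + (0 : ℝ) • (stdVec l : Coord n) by simp] at h2
        have h3 := HasFDerivAt.comp_hasDerivAt (f := fun t : ℝ => p.1 + t • (stdVec l : Coord n))
          0 h2 h1
        simp only [zero_smul, add_zero] at h3
        exact h3)
    have h1 : ∀ c : Fin n → ℝ, ((0 : Coord n), -∑ i, c i • (stdVec i : Coord n))
        = -((0 : Coord n), ∑ i, c i • (stdVec i : Coord n)) := by simp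
    rw [h1, map_neg, fderiv_inr_sum] at h
    have h2 : ∀ j, (horizLift (christoffel G) l p).2 j
        = -∑ m, christoffel G j l m p.1 * p.2 m := fun j => by
      simp only [horizLift, PiLp.neg_apply, sum_smul_stdVec_apply]
    simp only [h2, mul_neg, ← sub_eq_add_neg] at h
    linarith
  have hs := (hf.isSymmSndFDerivAt (by simp)) (horizLift (christoffel G) l p)
    (horizLift (christoffel G) k p)
  rw [key k l, key l k, ← sub_eq_zero, ← Finset.sum_sub_distrib] at hs
  rw [← neg_eq_zero, ← hs, ← Finset.sum_neg_distrib]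
  refine Finset.sum_congr rfl fun i _ => ?_
  rw [← sub_mul, ← neg_mul]
  congr 1
  have h3 : ∀ k l, ∑ j, christoffel G i k j p.1 * ∑ m, christoffel G j l m p.1 * p.2 m
      = ∑ j, (∑ m, christoffel G i k m p.1 * christoffel G m l j p.1) * p.2 j := fun k l => by
    simp only [Finset.mul_sum, Finset.sum_mul]
    rw [Finset.sum_comm]
    exact Finset.sum_congr rfl fun j _ => Finset.sum_congr rfl fun m _ => by ring
  simp only [Finset.sum_sub_distrib, h3]
  simp only [← Finset.sum_sub_distrib, ← Finset.sum_neg_distrib]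
  refine Finset.sum_congr rfl fun j _ => ?_
  have h4 : ∀ i k, christoffel G i j k = christoffel G i k j := fun i k =>
    funext fun z => christoffel_symm hG i j k z
  simp only [curvTensor, h4]
  ring

/-- The Riemann curvature of a spray that is quadratic in `y` near `(z, w)`. -/
theorem riemannCoeff_eq_curvTensor {G : Coord n → Matrix (Fin n) (Fin n) ℝ}
    {f : Coord n → Coord n → ℝ} {z w : Coord n}
    (hΓ : ∀ᶠ z' in nhds z, ∀ i j k, DifferentiableAt ℝ (christoffel G i j k) z')
    (hG : ∀ z i j, G z i j = G z j i)
    (hf : ∀ᶠ q in nhds (z, w), ∀ i,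
      sprayCoeff f i q.1 q.2 = (1 / 2) * ∑ j, ∑ k, christoffel G i j k q.1 * q.2 j * q.2 k)
    (i k : Fin n) :
    riemannCoeff f i k z w = ∑ j, ∑ l, curvTensor G i j k l z * w j * w l := by
  have hs : ∀ i j k, christoffel G i j k = christoffel G i k j := fun i j k =>
    funext fun z => christoffel_symm hG i j k z
  have hc : ∀ (q : Coord n × Coord n) (j : Fin n),
      HasFDerivAt (fun q : Coord n × Coord n => q.2 j)
        ((EuclideanSpace.proj (𝕜 := ℝ) j).comp (ContinuousLinearMap.snd ℝ _ _)) q := fun q j =>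
    ((EuclideanSpace.proj (𝕜 := ℝ) j).comp
      (ContinuousLinearMap.snd ℝ (Coord n) (Coord n))).hasFDerivAt
  have hch : ∀ q : Coord n × Coord n, (∀ i j k, DifferentiableAt ℝ (christoffel G i j k) q.1) →
      ∀ i j k, HasFDerivAt (fun q : Coord n × Coord n => christoffel G i j k q.1)
        ((fderiv ℝ (christoffel G i j k) q.1).comp (ContinuousLinearMap.fst ℝ _ _)) q :=
    fun q hq i j k => HasFDerivAt.comp (f := Prod.fst) q (hq i j k).hasFDerivAt hasFDerivAt_fst
  have hΓ' : ∀ᶠ q in nhds (z, w), ∀ i j k, DifferentiableAt ℝ (christoffel G i j k) q.1 :=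
    (continuous_fst.tendsto (z, w)).eventually hΓ
  -- the derivative of the quadratic spray
  have hD : ∀ᶠ q in nhds (z, w), ∀ i, HasFDerivAt (Function.uncurry (sprayCoeff f i))
      ((1 / 2 : ℝ) • ∑ j, ∑ k, ((christoffel G i j k q.1 * q.2 j) •
        ((EuclideanSpace.proj (𝕜 := ℝ) k).comp (ContinuousLinearMap.snd ℝ _ _))
        + q.2 k • (christoffel G i j k q.1 •
          ((EuclideanSpace.proj (𝕜 := ℝ) j).comp (ContinuousLinearMap.snd ℝ _ _))
          + q.2 j • ((fderiv ℝ (christoffel G i j k) q.1).comp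
            (ContinuousLinearMap.fst ℝ _ _))))) q := by
    filter_upwards [hΓ', hf.eventually_nhds] with q hq hfq i
    refine HasFDerivAt.congr_of_eventuallyEq ?_ (hfq.mono fun q' hq' => hq' i)
    exact (HasFDerivAt.fun_sum fun j _ => HasFDerivAt.fun_sum fun k _ =>
      ((hch q hq i j k).fun_mul (hc q j)).fun_mul (hc q k)).const_mul _
  have hdx : ∀ᶠ q in nhds (z, w), ∀ i k, dx k (sprayCoeff f i) q.1 q.2
      = (1 / 2) * ∑ j, ∑ l, pd k (christoffel G i j l) q.1 * q.2 j * q.2 l := by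
    filter_upwards [hD] with q hq i k
    rw [dx_eq_fderiv k (hq i).differentiableAt, (hq i).fderiv]
    simp [sum_apply, pd, mul_comm, mul_left_comm]
  have hdy : ∀ᶠ q in nhds (z, w), ∀ i k, dy k (sprayCoeff f i) q.1 q.2
      = ∑ j, christoffel G i k j q.1 * q.2 j := by
    filter_upwards [hD] with q hq i k
    rw [dy_eq_fderiv k (hq i).differentiableAt, (hq i).fderiv]
    simp [sum_apply, stdVec, Finset.sum_add_distrib]
    simp only [hs i _ k, mul_comm (q.2 _)]
    ring
  have hD2 : ∀ i k, HasFDerivAt (Function.uncurry (dy k (sprayCoeff f i)))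
      (∑ j, (christoffel G i k j z •
          ((EuclideanSpace.proj (𝕜 := ℝ) j).comp (ContinuousLinearMap.snd ℝ _ _))
          + w j • ((fderiv ℝ (christoffel G i k j) z).comp
            (ContinuousLinearMap.fst ℝ _ _)))) (z, w) := fun i k => by
    refine HasFDerivAt.congr_of_eventuallyEq ?_ (hdy.mono fun q' hq' => hq' i k)
    exact HasFDerivAt.fun_sum fun j _ => (hch (z, w) hΓ'.self_of_nhds i k j).fun_mul (hc (z, w) j)
  have hdxy : ∀ i j k, dx j (dy k (sprayCoeff f i)) z w
      = ∑ l, pd j (christoffel G i k l) z * w l := fun i j k => by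
    rw [dx_eq_fderiv j (hD2 i k).differentiableAt, (hD2 i k).fderiv]
    simp [sum_apply, pd, mul_comm]
  have hdyy : ∀ i j k, dy j (dy k (sprayCoeff f i)) z w = christoffel G i k j z := fun i j k => by
    rw [dy_eq_fderiv j (hD2 i k).differentiableAt, (hD2 i k).fderiv]
    simp [sum_apply, stdVec]
  have hdx0 := hdx.self_of_nhds
  have hdy0 := hdy.self_of_nhds
  have hf0 := hf.self_of_nhds
  simp only at hdx0 hdy0 hf0
  simp only [riemannCoeff, hdx0, hdxy, hdyy, hdy0, hf0]
  have e1 : ∑ j, w j * ∑ l, pd j (christoffel G i k l) z * w l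
      = ∑ j, ∑ l, pd l (christoffel G i j k) z * w j * w l := by
    rw [Finset.sum_comm]
    refine Finset.sum_congr rfl fun l _ => ?_
    rw [Finset.mul_sum]
    refine Finset.sum_congr rfl fun j _ => ?_
    rw [hs i k j]; ring
  have e2 : ∑ j, (1 / 2 * ∑ a, ∑ b, christoffel G j a b z * w a * w b) * christoffel G i k j z
      = (1 / 2) * ∑ j, ∑ l, (∑ m, christoffel G i k m z * christoffel G m j l z) * w j * w l := by
    simp only [Finset.mul_sum, Finset.sum_mul]
    rw [Finset.sum_comm]
    refine Finset.sum_congr rfl fun a _ => ?_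
    rw [Finset.sum_comm]
    refine Finset.sum_congr rfl fun b _ => Finset.sum_congr rfl fun j _ => ?_
    ring
  have e3 : ∑ j, (∑ a, christoffel G i j a z * w a) * ∑ b, christoffel G j k b z * w b
      = ∑ j, ∑ l, (∑ m, christoffel G i l m z * christoffel G m j k z) * w j * w l := by
    simp only [Finset.mul_sum, Finset.sum_mul]
    rw [Finset.sum_comm]
    refine Finset.sum_congr rfl fun b _ => ?_
    rw [Finset.sum_comm]
    refine Finset.sum_congr rfl fun a _ => Finset.sum_congr rfl fun j _ => ?_
    rw [hs i j a, hs j k b]; ring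
  rw [e1, e2, e3]
  simp only [curvTensor, sub_mul, add_mul, Finset.sum_add_distrib, Finset.sum_sub_distrib]
  ring

end Curvature

/-! ### Metrics and parallel forms are horizontally constant -/

section HorizontalForms

variable {n : ℕ}

theorem hasFDerivAt_coord_snd (p : Coord n × Coord n) (i : Fin n) :
    HasFDerivAt (fun q : Coord n × Coord n => q.2 i)
      ((EuclideanSpace.proj (𝕜 := ℝ) i).comp (ContinuousLinearMap.snd ℝ _ _)) p :=
  ((EuclideanSpace.proj (𝕜 := ℝ) i).comp
    (ContinuousLinearMap.snd ℝ (Coord n) (Coord n))).hasFDerivAt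

theorem fderiv_linearForm {b : Fin n → Coord n → ℝ} {p : Coord n × Coord n}
    (hb : ∀ i, DifferentiableAt ℝ (b i) p.1) (v : Coord n × Coord n) :
    fderiv ℝ (fun q : Coord n × Coord n => ∑ i, b i q.1 * q.2 i) p v
      = ∑ i, (fderiv ℝ (b i) p.1 v.1 * p.2 i + b i p.1 * v.2 i) := by
  have h : HasFDerivAt (fun q : Coord n × Coord n => ∑ i, b i q.1 * q.2 i) _ p :=
    HasFDerivAt.fun_sum fun i _ =>
      (HasFDerivAt.comp (f := Prod.fst) p (hb i).hasFDerivAt hasFDerivAt_fst).fun_mul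
        (hasFDerivAt_coord_snd p i)
  rw [h.fderiv, sum_apply]
  refine Finset.sum_congr rfl fun i _ => ?_
  simp
  ring

theorem fderiv_quadraticForm {G : Coord n → Matrix (Fin n) (Fin n) ℝ} {p : Coord n × Coord n}
    (hG : ∀ i j, DifferentiableAt ℝ (fun z => G z i j) p.1) (v : Coord n × Coord n) :
    fderiv ℝ (fun q : Coord n × Coord n => ∑ i, ∑ j, G q.1 i j * q.2 i * q.2 j) p v
      = (∑ i, ∑ j, fderiv ℝ (fun z => G z i j) p.1 v.1 * p.2 i * p.2 j)
        + (∑ i, ∑ j, G p.1 i j * v.2 i * p.2 j) + ∑ i, ∑ j, G p.1 i j * p.2 i * v.2 j := by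
  have h : HasFDerivAt (fun q : Coord n × Coord n => ∑ i, ∑ j, G q.1 i j * q.2 i * q.2 j) _ p :=
    HasFDerivAt.fun_sum fun i _ => HasFDerivAt.fun_sum fun j _ =>
      ((HasFDerivAt.comp (g := fun z => G z i j) (f := Prod.fst) p (hG i j).hasFDerivAt
        hasFDerivAt_fst).fun_mul (hasFDerivAt_coord_snd p i)).fun_mul (hasFDerivAt_coord_snd p j)
  rw [h.fderiv]
  simp only [sum_apply, ← Finset.sum_add_distrib]
  refine Finset.sum_congr rfl fun i _ => Finset.sum_congr rfl fun j _ => ?_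
  simp
  ring

theorem horizLift_snd_apply (Γ : Fin n → Fin n → Fin n → Coord n → ℝ) (k : Fin n)
    (p : Coord n × Coord n) (i : Fin n) :
    (horizLift Γ k p).2 i = -∑ j, Γ i k j p.1 * p.2 j := by
  simp only [horizLift, PiLp.neg_apply, sum_smul_stdVec_apply]

/-- A 1-form that is parallel for a torsion-free connection is horizontally constant as a
function on the tangent bundle. -/
theorem fderiv_linearForm_horizLift {Γ : Fin n → Fin n → Fin n → Coord n → ℝ}
    {b : Fin n → Coord n → ℝ} {p : Coord n × Coord n} (hb : ∀ i, DifferentiableAt ℝ (b i) p.1)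
    (hΓ : ∀ i j k, Γ i j k p.1 = Γ i k j p.1)
    (hpar : ∀ i j, pd j (b i) p.1 - ∑ k, Γ k i j p.1 * b k p.1 = 0) (k : Fin n) :
    fderiv ℝ (fun q : Coord n × Coord n => ∑ i, b i q.1 * q.2 i) p (horizLift Γ k p) = 0 := by
  rw [fderiv_linearForm hb]
  simp only [horizLift_snd_apply, Finset.sum_add_distrib]
  have h1 : ∀ i, fderiv ℝ (b i) p.1 (horizLift Γ k p).1 = ∑ m, Γ m i k p.1 * b m p.1 :=
    fun i => sub_eq_zero.1 (hpar i k)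
  simp only [h1, mul_neg, Finset.sum_neg_distrib, Finset.mul_sum, Finset.sum_mul]
  rw [Finset.sum_comm, ← sub_eq_add_neg, sub_eq_zero]
  refine Finset.sum_congr rfl fun i _ => Finset.sum_congr rfl fun j _ => ?_
  rw [hΓ i j k]; ring

/-- The metric is horizontally constant for its Levi-Civita connection. -/
theorem fderiv_quadraticForm_horizLift {G : Coord n → Matrix (Fin n) (Fin n) ℝ}
    {p : Coord n × Coord n} (hG : ∀ i j, DifferentiableAt ℝ (fun z => G z i j) p.1)
    (hsymm : ∀ z i j, G z i j = G z j i) (hdet : IsUnit (G p.1).det) (k : Fin n) :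
    fderiv ℝ (fun q : Coord n × Coord n => ∑ i, ∑ j, G q.1 i j * q.2 i * q.2 j) p
      (horizLift (christoffel G) k p) = 0 := by
  rw [fderiv_quadraticForm hG]
  simp only [horizLift_snd_apply]
  have h1 : ∀ i j, fderiv ℝ (fun z => G z i j) p.1 (horizLift (christoffel G) k p).1
      = ∑ m, G p.1 j m * christoffel G m k i p.1 + ∑ m, G p.1 i m * christoffel G m k j p.1 :=
    fun i j => pd_metric hsymm hdet i j k
  have e1 : ∑ i, ∑ j, (∑ m, G p.1 j m * christoffel G m k i p.1) * p.2 i * p.2 j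
      = ∑ i, ∑ j, G p.1 i j * p.2 i * ∑ m, christoffel G j k m p.1 * p.2 m := by
    simp only [Finset.mul_sum, Finset.sum_mul]
    rw [Finset.sum_comm]
    refine Finset.sum_congr rfl fun j _ => ?_
    rw [Finset.sum_comm]
    refine Finset.sum_congr rfl fun m _ => Finset.sum_congr rfl fun i _ => ?_
    ring
  have e2 : ∑ i, ∑ j, (∑ m, G p.1 i m * christoffel G m k j p.1) * p.2 i * p.2 j
      = ∑ i, ∑ j, G p.1 i j * (∑ m, christoffel G i k m p.1 * p.2 m) * p.2 j := by
    conv_rhs => rw [Finset.sum_comm]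
    simp only [Finset.mul_sum, Finset.sum_mul]
    refine Finset.sum_congr rfl fun i _ => ?_
    rw [Finset.sum_comm]
    refine Finset.sum_congr rfl fun m _ => Finset.sum_congr rfl fun j _ => ?_
    rw [hsymm _ m i]; ring
  simp only [h1, add_mul, Finset.sum_add_distrib, e1, e2, mul_neg, neg_mul,
    Finset.sum_neg_distrib]
  ring

/-- Contracted form of `fderiv_curvTensor_eq_zero`: horizontally constant functions are
annihilated by the vertical vector with components `Rⁱⱼₖₗ yʲ uᵏ yˡ`. -/
theorem fderiv_curvVector_eq_zero {G : Coord n → Matrix (Fin n) (Fin n) ℝ}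
    {f : Coord n × Coord n → ℝ} {p : Coord n × Coord n}
    (hΓ : ∀ i j k, DifferentiableAt ℝ (christoffel G i j k) p.1)
    (hG : ∀ z i j, G z i j = G z j i)
    (hf : ContDiffAt ℝ 2 f p)
    (h0 : ∀ᶠ q in nhds p, ∀ k, fderiv ℝ f q (horizLift (christoffel G) k q) = 0) (u : Coord n) :
    fderiv ℝ f p (0, ∑ i, (∑ j, ∑ k, ∑ l, curvTensor G i j k l p.1 * p.2 j * u k * p.2 l)
      • stdVec i) = 0 := by
  rw [fderiv_inr_sum]
  have h : ∑ k, ∑ l, (u k * p.2 l) *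
      ∑ i, (∑ j, curvTensor G i j k l p.1 * p.2 j) * fderiv ℝ f p (0, stdVec i) = 0 :=
    Finset.sum_eq_zero fun k _ => Finset.sum_eq_zero fun l _ => by
      rw [fderiv_curvTensor_eq_zero hΓ hG hf h0 k l, mul_zero]
  rw [← h]
  have e : ∀ i, (∑ j, ∑ k, ∑ l, curvTensor G i j k l p.1 * p.2 j * u k * p.2 l)
      * fderiv ℝ f p (0, stdVec i)
      = ∑ k, ∑ l, (u k * p.2 l) * ((∑ j, curvTensor G i j k l p.1 * p.2 j)
        * fderiv ℝ f p (0, stdVec i)) := fun i => by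
    rw [Finset.sum_comm]
    simp only [Finset.sum_mul]
    refine Finset.sum_congr rfl fun k _ => ?_
    rw [Finset.sum_comm]
    refine Finset.sum_congr rfl fun l _ => ?_
    rw [Finset.mul_sum]
    refine Finset.sum_congr rfl fun j _ => ?_
    ring
  simp only [e]
  rw [Finset.sum_comm]
  refine Finset.sum_congr rfl fun k _ => ?_
  rw [Finset.sum_comm]
  exact Finset.sum_congr rfl fun l _ => (Finset.mul_sum _ _ _).symm

theorem isUnit_det_of_forall_pos {A : Matrix (Fin n) (Fin n) ℝ}
    (hA : ∀ c : Fin n → ℝ, c ≠ 0 → 0 < ∑ i, ∑ j, A i j * c i * c j) : IsUnit A.det := by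
  rw [← Matrix.isUnit_iff_isUnit_det, ← Matrix.mulVec_injective_iff_isUnit]
  intro a b hab
  by_contra hne
  have h0 : A.mulVec (a - b) = 0 := by rw [Matrix.mulVec_sub]; exact sub_eq_zero.2 hab
  refine (hA (a - b) (sub_ne_zero.2 hne)).ne' ?_
  refine Finset.sum_eq_zero fun i _ => ?_
  have h1 := congrFun h0 i
  simp only [Matrix.mulVec, dotProduct, Pi.zero_apply] at h1
  calc ∑ j, A i j * (a - b) i * (a - b) j = (a - b) i * ∑ j, A i j * (a - b) j := by
        rw [Finset.mul_sum]; exact Finset.sum_congr rfl fun j _ => by ring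
    _ = 0 := by rw [h1, mul_zero]

end HorizontalForms

/-! ### The second derivative of `α² φ(β/α)²` -/

section FundamentalTensor

/-- The mixed second derivative of `F² = α² φ(β/α)²` along `y + σu + τv`, where
`a, p, q, k, l, m` stand for `g(y,y), g(y,u), g(y,v), g(u,v), g(u,u), g(v,v)` and `b, c, d` for
`β(y), β(u), β(v)`. -/
theorem deriv_deriv_alphaBeta {ψ : ℝ → ℝ} {a p q k l m b c d : ℝ} (ha : 0 < a)
    (hψ : ContDiffAt ℝ 2 ψ (b / √a)) :
    (1 / 2) * deriv (fun σ : ℝ => deriv (fun τ : ℝ =>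
      (√(a + 2 * σ * p + 2 * τ * q + σ ^ 2 * l + 2 * σ * τ * k + τ ^ 2 * m) *
        ψ ((b + σ * c + τ * d) /
          √(a + 2 * σ * p + 2 * τ * q + σ ^ 2 * l + 2 * σ * τ * k + τ ^ 2 * m))) ^ 2) 0) 0
      = ψ (b / √a) * (ψ (b / √a) - b / √a * deriv ψ (b / √a)) * k
        + (ψ (b / √a) * deriv (deriv ψ) (b / √a) + deriv ψ (b / √a) ^ 2) * (c * d)
        + ((ψ (b / √a) - b / √a * deriv ψ (b / √a)) * deriv ψ (b / √a)
            - b / √a * ψ (b / √a) * deriv (deriv ψ) (b / √a))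
          * ((c * q + d * p) / √a - b / √a * (p * q) / a) := by
  -- the norm `√g(y + σu, y + σu)`
  set r : ℝ → ℝ := fun σ => √(a + 2 * σ * p + σ ^ 2 * l) with hr
  have hr0 : r 0 = √a := by simp [hr]
  have hra : √a ^ 2 = a := Real.sq_sqrt ha.le
  have hrp : 0 < √a := Real.sqrt_pos.2 ha
  have hpol : HasDerivAt (fun σ : ℝ => a + 2 * σ * p + σ ^ 2 * l) (2 * p) 0 := by
    have h1 := (((hasDerivAt_id (0 : ℝ)).const_mul 2).mul_const p).const_add a
    have h2 := (((hasDerivAt_id (0 : ℝ)).pow 2).mul_const l)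
    simpa using h1.fun_add h2
  have hrd : HasDerivAt r (p / √a) 0 := by
    have h := hpol.sqrt (by simpa using ha.ne')
    convert! h using 1
    simp only [mul_zero, zero_mul, add_zero, ne_eq, OfNat.ofNat_ne_zero, not_false_eq_true,
      zero_pow]
    field_simp
  have hsd : HasDerivAt (fun σ : ℝ => (b + σ * c) / r σ) ((c * √a - b * (p / √a)) / a) 0 := by
    have h1 := ((hasDerivAt_id (0 : ℝ)).mul_const c).const_add b
    have h2 := h1.fun_div hrd (by rw [hr0]; exact hrp.ne')
    simpa [hr0, hra] using h2
  have hψd : ∀ᶠ s in nhds (b / √a), HasDerivAt ψ (deriv ψ s) s := by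
    filter_upwards [hψ.eventually (by simp)] with s hs
    exact (hs.differentiableAt (by simp)).hasDerivAt
  have hψ2 : HasDerivAt (deriv ψ) (deriv (deriv ψ) (b / √a)) (b / √a) := by
    have h : ContDiffAt ℝ 1 (deriv ψ) (b / √a) := by
      have h1 := (hψ.fderiv_right (m := 1) (by norm_num)).clm_apply
        (contDiffAt_const (c := (1 : ℝ)))
      exact h1
    exact (h.differentiableAt (by simp)).hasDerivAt
  -- the inner derivative, for `σ` near `0` where `g(y + σu, y + σu) > 0`
  have hinner : ∀ᶠ σ in nhds (0 : ℝ), deriv (fun τ : ℝ =>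
      (√(a + 2 * σ * p + 2 * τ * q + σ ^ 2 * l + 2 * σ * τ * k + τ ^ 2 * m) *
        ψ ((b + σ * c + τ * d) /
          √(a + 2 * σ * p + 2 * τ * q + σ ^ 2 * l + 2 * σ * τ * k + τ ^ 2 * m))) ^ 2) 0
      = 2 * ψ ((b + σ * c) / r σ) * ((q + σ * k) * (ψ ((b + σ * c) / r σ)
        - (b + σ * c) / r σ * deriv ψ ((b + σ * c) / r σ))
          + r σ * d * deriv ψ ((b + σ * c) / r σ)) := by
    have e1 : ∀ᶠ σ in nhds (0 : ℝ), 0 < a + 2 * σ * p + σ ^ 2 * l :=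
      hpol.continuousAt.eventually_const_lt (by simpa using ha)
    have e2 := hsd.continuousAt.tendsto.eventually
      (p := fun s => HasDerivAt ψ (deriv ψ s) s) (by rw [hr0, zero_mul, add_zero]; exact hψd)
    filter_upwards [e1, e2] with σ h1 h2
    have hσ : 0 < r σ := Real.sqrt_pos.2 h1
    have hσ2 : r σ ^ 2 = a + 2 * σ * p + σ ^ 2 * l := Real.sq_sqrt h1.le
    have d1 : HasDerivAt (fun τ : ℝ =>
        a + 2 * σ * p + 2 * τ * q + σ ^ 2 * l + 2 * σ * τ * k + τ ^ 2 * m)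
        (2 * (q + σ * k)) 0 := by
      have t1 := ((hasDerivAt_id (0 : ℝ)).const_mul 2).mul_const q
      have t2 := ((hasDerivAt_id (0 : ℝ)).const_mul (2 * σ)).mul_const k
      have t3 := (((hasDerivAt_id (0 : ℝ)).pow 2).mul_const m)
      have t4 := (((t1.const_add (a + 2 * σ * p)).add_const (σ ^ 2 * l)).fun_add t2).fun_add t3
      simp only [id_eq] at t4
      convert! t4 using 1
      simp
      ring
    have hval : √(a + 2 * σ * p + 2 * 0 * q + σ ^ 2 * l + 2 * σ * 0 * k + 0 ^ 2 * m) = r σ := by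
      simp [hr]
    have d2 : HasDerivAt (fun τ : ℝ =>
        √(a + 2 * σ * p + 2 * τ * q + σ ^ 2 * l + 2 * σ * τ * k + τ ^ 2 * m))
        ((q + σ * k) / r σ) 0 := by
      have t := d1.sqrt (by simpa using h1.ne')
      rw [hval] at t
      convert! t using 1
      field_simp
    have d3 : HasDerivAt (fun τ : ℝ => (b + σ * c + τ * d) /
        √(a + 2 * σ * p + 2 * τ * q + σ ^ 2 * l + 2 * σ * τ * k + τ ^ 2 * m))
        ((d * r σ - (b + σ * c) * ((q + σ * k) / r σ)) / r σ ^ 2) 0 := by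
      have t1 := ((hasDerivAt_id (0 : ℝ)).mul_const d).const_add (b + σ * c)
      have t2 := t1.fun_div d2 (by rw [hval]; exact hσ.ne')
      rw [hval] at t2
      simpa using t2
    have hval2 : (b + σ * c + 0 * d) /
        √(a + 2 * σ * p + 2 * 0 * q + σ ^ 2 * l + 2 * σ * 0 * k + 0 ^ 2 * m)
        = (b + σ * c) / r σ := by rw [hval, zero_mul, add_zero]
    have d4 := HasDerivAt.comp (h₂ := ψ) (0 : ℝ) (by rw [hval2]; exact h2) d3
    have d5 := (d2.fun_mul d4).fun_pow 2
    simp only [Function.comp] at d5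
    rw [hval2, hval] at d5
    rw [d5.deriv]
    field_simp
    ring
  rw [Filter.EventuallyEq.deriv_eq hinner]
  have hv : (b + 0 * c) / r 0 = b / √a := by rw [hr0]; simp
  have f1 : HasDerivAt (fun σ : ℝ => ψ ((b + σ * c) / r σ)) _ 0 :=
    HasDerivAt.comp (h₂ := ψ) (0 : ℝ) (by rw [hv]; exact hψd.self_of_nhds) hsd
  have f2 : HasDerivAt (fun σ : ℝ => deriv ψ ((b + σ * c) / r σ)) _ 0 :=
    HasDerivAt.comp (h₂ := deriv ψ) (0 : ℝ) (by rw [hv]; exact hψ2) hsd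
  have f3 : HasDerivAt (fun σ : ℝ => q + σ * k) k 0 := by
    simpa using ((hasDerivAt_id (0 : ℝ)).mul_const k).const_add q
  have f4 := (f1.const_mul 2).fun_mul ((f3.fun_mul (f1.fun_sub (hsd.fun_mul f2))).fun_add
    ((hrd.mul_const d).fun_mul f2))
  rw [f4.deriv, hv, hr0]
  simp only [zero_mul, add_zero]
  generalize deriv (deriv ψ) (b / √a) = w2
  generalize deriv ψ (b / √a) = w1
  generalize ψ (b / √a) = w0
  rw [← hra]
  generalize √a = A at hrp
  rw [Real.sqrt_sq hrp.le]
  field_simp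
  ring

end FundamentalTensor

/-! ### Tangent vectors, metrics and forms in a chart -/

section ChartCoordinates

variable {n : ℕ} {M : Type*} [TopologicalSpace M] [ChartedSpace (Coord n) M]

theorem ofCoord_add (e : OpenPartialHomeomorph M (Coord n)) (z v w : Coord n) :
    ofCoord e z (v + w) = ofCoord e z v + ofCoord e z w :=
  map_add (mfderiv (𝓡 n) (𝓡 n) e.symm z) v w

theorem ofCoord_smul (e : OpenPartialHomeomorph M (Coord n)) (z : Coord n) (c : ℝ) (w : Coord n) :
    ofCoord e z (c • w) = c • ofCoord e z w :=
  map_smul (mfderiv (𝓡 n) (𝓡 n) e.symm z) c w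

theorem ofCoord_sum {ι : Type*} (e : OpenPartialHomeomorph M (Coord n)) (z : Coord n)
    (S : Finset ι) (w : ι → Coord n) :
    ofCoord e z (∑ i ∈ S, w i) = ∑ i ∈ S, ofCoord e z (w i) :=
  map_sum (mfderiv (𝓡 n) (𝓡 n) e.symm z) w S

theorem chart_mdifferentiable {e : OpenPartialHomeomorph M (Coord n)}
    (he : e ∈ IsManifold.maximalAtlas (𝓡 n) ∞ M) : e.MDifferentiable (𝓡 n) (𝓡 n) :=
  ⟨(contMDiffOn_of_mem_maximalAtlas he).mdifferentiableOn (by simp),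
    (contMDiffOn_symm_of_mem_maximalAtlas he).mdifferentiableOn (by simp)⟩

theorem toCoord_ofCoord {e : OpenPartialHomeomorph M (Coord n)}
    (he : e ∈ IsManifold.maximalAtlas (𝓡 n) ∞ M) {z : Coord n} (hz : z ∈ e.target) (w : Coord n) :
    toCoord e (e.symm z) (ofCoord e z w) = w :=
  DFunLike.congr_fun ((chart_mdifferentiable he).comp_symm_deriv hz) w

theorem ofCoord_toCoord {e : OpenPartialHomeomorph M (Coord n)}
    (he : e ∈ IsManifold.maximalAtlas (𝓡 n) ∞ M) {z : Coord n} (hz : z ∈ e.target)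
    (v : TangentSpace (𝓡 n) (e.symm z)) :
    ofCoord e z (toCoord e (e.symm z) v) = v := by
  have h := DFunLike.congr_fun ((chart_mdifferentiable he).symm_comp_deriv (e.map_target hz)) v
  rw [e.right_inv hz] at h
  exact h

/-- The two constructions of a tangent vector from its coordinates agree. -/
theorem vecOfCoord_symm {e : OpenPartialHomeomorph M (Coord n)}
    (he : e ∈ IsManifold.maximalAtlas (𝓡 n) ∞ M) {z : Coord n} (hz : z ∈ e.target) (w : Coord n) :
    vecOfCoord e (e.symm z) w = ofCoord e z w := by
  have hd := chart_mdifferentiable he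
  have h := DFunLike.congr_fun (ContinuousLinearMap.inverse_equiv (hd.mfderiv (e.map_target hz))) w
  refine h.trans ?_
  change mfderiv (𝓡 n) (𝓡 n) e.symm (e (e.symm z)) w = _
  rw [e.right_inv hz]
  rfl

theorem ofCoord_eq_zero {e : OpenPartialHomeomorph M (Coord n)}
    (he : e ∈ IsManifold.maximalAtlas (𝓡 n) ∞ M) {z : Coord n} (hz : z ∈ e.target) {w : Coord n} :
    ofCoord e z w = 0 ↔ w = 0 := by
  refine ⟨fun h => ?_, fun h => by rw [h]; exact map_zero (mfderiv (𝓡 n) (𝓡 n) e.symm z)⟩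
  rw [← toCoord_ofCoord he hz w, h]
  exact map_zero (mfderiv (𝓡 n) (𝓡 n) e (e.symm z))

variable [IsManifold (𝓡 n) ∞ M]

theorem contMDiffAt_ofCoord {e : OpenPartialHomeomorph M (Coord n)}
    (he : e ∈ IsManifold.maximalAtlas (𝓡 n) ∞ M) {z : Coord n} (hz : z ∈ e.target) (w : Coord n) :
    ContMDiffAt (𝓡 n) (𝓡 n).tangent ∞
      (fun z' => (⟨e.symm z', ofCoord e z' w⟩ : TangentBundle (𝓡 n) M)) z := by
  have h1 := (contMDiffOn_symm_of_mem_maximalAtlas he).contMDiffOn_tangentMapWithin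
    (m := ∞) (by simp) e.open_target.uniqueMDiffOn
  have h2 : ContMDiffAt (𝓡 n) (𝓡 n).tangent ∞
      (fun z' => (⟨z', w⟩ : TangentBundle (𝓡 n) (Coord n))) z :=
    contMDiffAt_vectorSpace_iff_contDiffAt.2 contDiffAt_const
  have h3 := ContMDiffWithinAt.comp z (h1 ⟨z, w⟩ hz) (s := e.target) h2.contMDiffWithinAt
    fun z' hz' => hz'
  refine (h3.contMDiffAt (e.open_target.mem_nhds hz)).congr_of_eventuallyEq ?_
  filter_upwards [e.open_target.mem_nhds hz] with z' hz'
  simp only [Function.comp, tangentMapWithin, ofCoord]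
  rw [mfderivWithin_of_isOpen e.open_target hz']

theorem contDiffAt_metricMatrix {e : OpenPartialHomeomorph M (Coord n)}
    (he : e ∈ IsManifold.maximalAtlas (𝓡 n) ∞ M) (g : RiemMetric n M) (i j : Fin n)
    {z : Coord n} (hz : z ∈ e.target) :
    ContDiffAt ℝ ∞ (fun z' => metricMatrix e g z' i j) z := by
  have h0 : ContMDiffAt (𝓡 n) (𝓡 n) ∞ e.symm z :=
    (contMDiffOn_symm_of_mem_maximalAtlas he).contMDiffAt (e.open_target.mem_nhds hz)
  have h := ContMDiffAt.clm_bundle_apply₂ (F₃ := ℝ) (E₃ := fun _ : M => ℝ)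
    ((g.contMDiff (e.symm z)).comp z h0)
    (contMDiffAt_ofCoord he hz (stdVec i)) (contMDiffAt_ofCoord he hz (stdVec j))
  rw [Bundle.contMDiffAt_totalSpace] at h
  exact h.2.contDiffAt

theorem contDiffAt_formCoeff {e : OpenPartialHomeomorph M (Coord n)}
    (he : e ∈ IsManifold.maximalAtlas (𝓡 n) ∞ M) (β : OneForm n M) (i : Fin n)
    {z : Coord n} (hz : z ∈ e.target) :
    ContDiffAt ℝ ∞ (formCoeff e β i) z := by
  have h0 : ContMDiffAt (𝓡 n) (𝓡 n) ∞ e.symm z :=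
    (contMDiffOn_symm_of_mem_maximalAtlas he).contMDiffAt (e.open_target.mem_nhds hz)
  have h := ContMDiffAt.clm_bundle_apply (F₂ := ℝ) (E₂ := fun _ : M => ℝ)
    ((β.contMDiff (e.symm z)).comp z h0) (contMDiffAt_ofCoord he hz (stdVec i))
  rw [Bundle.contMDiffAt_totalSpace] at h
  exact h.2.contDiffAt

theorem inner_ofCoord (e : OpenPartialHomeomorph M (Coord n)) (g : RiemMetric n M)
    (z v w : Coord n) :
    g.inner (e.symm z) (ofCoord e z v) (ofCoord e z w)
      = ∑ i, ∑ j, metricMatrix e g z i j * v i * w j := by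
  conv_lhs => rw [coord_eq_sum v, coord_eq_sum w]
  simp only [ofCoord_sum, ofCoord_smul, map_sum, map_smul, sum_apply,
    smul_apply, smul_eq_mul, metricMatrix, Matrix.of_apply]
  simp only [Finset.mul_sum]
  rw [Finset.sum_comm]
  refine Finset.sum_congr rfl fun i _ => Finset.sum_congr rfl fun j _ => ?_
  ring

theorem form_ofCoord (e : OpenPartialHomeomorph M (Coord n)) (β : OneForm n M) (z w : Coord n) :
    β (e.symm z) (ofCoord e z w) = ∑ i, formCoeff e β i z * w i := by
  conv_lhs => rw [coord_eq_sum w]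
  simp only [ofCoord_sum, ofCoord_smul, map_sum, map_smul, smul_eq_mul, formCoeff, mul_comm]

end ChartCoordinates

/-! ### The fundamental tensor of an `(α, β)`-metric -/

section AlphaBeta

variable {n : ℕ} {M : Type*} [TopologicalSpace M] [ChartedSpace (Coord n) M]
  [IsManifold (𝓡 n) ∞ M]

theorem inner_self_nonneg (g : RiemMetric n M) (x : M) (v : TangentSpace (𝓡 n) x) :
    0 ≤ g.inner x v v := by
  by_cases h : v = 0
  · simp [h]
  · exact (g.pos x v h).le

theorem inner_sq_le (g : RiemMetric n M) (x : M) (v w : TangentSpace (𝓡 n) x) :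
    g.inner x v w ^ 2 ≤ g.inner x v v * g.inner x w w := by
  by_cases h : w = 0
  · simp [h]
  have hw := g.pos x w h
  have h1 := inner_self_nonneg g x (g.inner x w w • v - g.inner x v w • w)
  simp only [map_sub, map_smul, sub_apply, smul_apply, smul_eq_mul, g.symm x w v] at h1
  have h2 : 0 ≤ g.inner x w w * (g.inner x v v * g.inner x w w - g.inner x v w ^ 2) := by
    nlinarith [h1]
  nlinarith [nonneg_of_mul_nonneg_right h2 hw]

/-- The strict Cauchy–Schwarz inequality. -/
theorem inner_sq_lt (g : RiemMetric n M) (x : M) {v w : TangentSpace (𝓡 n) x}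
    (h : LinearIndependent ℝ ![v, w]) : g.inner x v w ^ 2 < g.inner x v v * g.inner x w w := by
  have hw : w ≠ 0 := h.ne_zero 1
  have hww := g.pos x w hw
  have hne : g.inner x w w • v - g.inner x v w • w ≠ 0 := fun h0 => by
    have h1 := LinearIndependent.pair_iff.1 h (g.inner x w w) (-g.inner x v w)
      (by rw [neg_smul, ← sub_eq_add_neg]; exact h0)
    exact hww.ne' h1.1
  have h1 := g.pos x _ hne
  simp only [map_sub, map_smul, sub_apply, smul_apply, smul_eq_mul, g.symm x w v] at h1
  have h2 : 0 < g.inner x w w * (g.inner x v v * g.inner x w w - g.inner x v w ^ 2) := by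
    nlinarith [h1]
  nlinarith [(mul_pos_iff_of_pos_left hww).1 h2]

theorem alpha_pos (g : RiemMetric n M) (x : M) {y : TangentSpace (𝓡 n) x} (hy : y ≠ 0) :
    0 < alpha g x y :=
  Real.sqrt_pos.2 (g.pos x y hy)

theorem alpha_sq (g : RiemMetric n M) (x : M) (y : TangentSpace (𝓡 n) x) :
    alpha g x y ^ 2 = g.inner x y y :=
  Real.sq_sqrt (inner_self_nonneg g x y)

namespace IsGeneralAlphaBeta

variable {F : TangentBundle (𝓡 n) M → ℝ} {g : RiemMetric n M} {β : OneForm n M} {b₀ : EReal}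
  {φ : ℝ → ℝ → ℝ}

/-- `|β(y)/α| ≤ b < b₀`, by the Cauchy–Schwarz inequality. -/
theorem mem_phiDomain (hF : IsGeneralAlphaBeta F g β b₀ φ) (x : M) {y : TangentSpace (𝓡 n) x}
    (hy : y ≠ 0) : (normSq g β x, β x y / alpha g x y) ∈ phiDomain b₀ := by
  refine ⟨inner_self_nonneg g x _, ?_, hF.norm_lt x⟩
  have hα := alpha_pos g x hy
  change |β x y / alpha g x y| ≤ √(normSq g β x)
  rw [abs_div, abs_of_pos hα, div_le_iff₀ hα, normSq, alpha,
    ← Real.sqrt_mul (inner_self_nonneg g x _)]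
  refine Real.abs_le_sqrt ?_
  rw [← inner_sharp g β]
  exact inner_sq_le g x _ y

theorem contDiffAt_phi (hF : IsGeneralAlphaBeta F g β b₀ φ) (x : M) {y : TangentSpace (𝓡 n) x}
    (hy : y ≠ 0) : ContDiffAt ℝ ∞ (φ (normSq g β x)) (β x y / alpha g x y) := by
  have h := hF.phi_smooth _ (hF.mem_phiDomain x hy)
  exact h.comp (g := fun q : ℝ × ℝ => φ q.1 q.2) (β x y / alpha g x y)
    (contDiffAt_const.prodMk contDiffAt_id)

/-- The fundamental tensor of `F = α φ(b², β/α)`. -/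
theorem fundTensor_eq (hF : IsGeneralAlphaBeta F g β b₀ φ) (x : M)
    {y : TangentSpace (𝓡 n) x} (hy : y ≠ 0) (u v : TangentSpace (𝓡 n) x) {t s : ℝ}
    (ht : t = normSq g β x) (hs : s = β x y / alpha g x y) :
    fundTensor F x y u v = φ t s * (φ t s - s * phi2 φ t s) * g.inner x u v
      + (φ t s * phi22 φ t s + phi2 φ t s ^ 2) * (β x u * β x v)
      + ((φ t s - s * phi2 φ t s) * phi2 φ t s - s * φ t s * phi22 φ t s)
        * ((β x u * g.inner x y v + β x v * g.inner x y u) / alpha g x y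
          - s * (g.inner x y u * g.inner x y v) / alpha g x y ^ 2) := by
  have hψ := (hF.contDiffAt_phi x hy).of_le (m := 2)
    (WithTop.coe_le_coe.2 le_top)
  have h := deriv_deriv_alphaBeta (p := g.inner x y u) (q := g.inner x y v) (k := g.inner x u v)
    (l := g.inner x u u) (m := g.inner x v v) (b := β x y) (c := β x u) (d := β x v)
    (g.pos x y hy) hψ
  have e : ∀ σ τ : ℝ, F ⟨x, y + σ • u + τ • v⟩
      = √(g.inner x y y + 2 * σ * g.inner x y u + 2 * τ * g.inner x y v + σ ^ 2 * g.inner x u u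
        + 2 * σ * τ * g.inner x u v + τ ^ 2 * g.inner x v v) * φ (normSq g β x)
        ((β x y + σ * β x u + τ * β x v) / √(g.inner x y y + 2 * σ * g.inner x y u
          + 2 * τ * g.inner x y v + σ ^ 2 * g.inner x u u
          + 2 * σ * τ * g.inner x u v + τ ^ 2 * g.inner x v v)) := fun σ τ => by
    have e1 : g.inner x (y + σ • u + τ • v) (y + σ • u + τ • v)
        = g.inner x y y + 2 * σ * g.inner x y u + 2 * τ * g.inner x y v + σ ^ 2 * g.inner x u u
        + 2 * σ * τ * g.inner x u v + τ ^ 2 * g.inner x v v := by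
      simp only [map_add, map_smul, add_apply, smul_apply, smul_eq_mul, g.symm x u y,
        g.symm x v y, g.symm x v u]
      ring
    rw [hF.eq, alpha, e1]
    simp only [map_add, map_smul, smul_eq_mul]
  unfold fundTensor
  simp only [e]
  rw [h, alpha_sq]
  subst ht hs
  rfl

theorem fundTensor_self (hF : IsGeneralAlphaBeta F g β b₀ φ) (x : M)
    {y : TangentSpace (𝓡 n) x} (hy : y ≠ 0) : fundTensor F x y y y = F ⟨x, y⟩ ^ 2 := by
  rw [hF.fundTensor_eq x hy y y rfl rfl, hF.eq, ← alpha_sq]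
  have hα := (alpha_pos g x hy).ne'
  field_simp
  ring

end IsGeneralAlphaBeta

end AlphaBeta

/-! ### Smoothness and horizontal constancy in a chart -/

section ChartExpressions

variable {n : ℕ} {M : Type*} [TopologicalSpace M] [ChartedSpace (Coord n) M]
  [IsManifold (𝓡 n) ∞ M] {e : OpenPartialHomeomorph M (Coord n)}

theorem metricMatrix_symm (e : OpenPartialHomeomorph M (Coord n)) (g : RiemMetric n M)
    (z : Coord n) (i j : Fin n) : metricMatrix e g z i j = metricMatrix e g z j i :=
  g.symm _ _ _

theorem isUnit_det_metricMatrix (he : e ∈ IsManifold.maximalAtlas (𝓡 n) ∞ M) (g : RiemMetric n M)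
    {z : Coord n} (hz : z ∈ e.target) : IsUnit (metricMatrix e g z).det := by
  refine isUnit_det_of_forall_pos fun c hc => ?_
  have h := inner_ofCoord e g z (WithLp.toLp 2 c) (WithLp.toLp 2 c)
  simp only at h
  rw [← h]
  refine g.pos _ _ fun h0 => hc ?_
  exact congrArg WithLp.ofLp ((ofCoord_eq_zero he hz).1 h0)

/-- In coordinates `b² = gⁱʲ bᵢ bⱼ`. -/
theorem normSq_eq (he : e ∈ IsManifold.maximalAtlas (𝓡 n) ∞ M) (g : RiemMetric n M)
    (β : OneForm n M) {z : Coord n} (hz : z ∈ e.target) :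
    normSq g β (e.symm z)
      = ∑ i, formCoeff e β i z * ∑ j, (metricMatrix e g z)⁻¹ i j * formCoeff e β j z := by
  set c := toCoord e (e.symm z) (sharp g β (e.symm z)) with hc
  have hX : ofCoord e z c = sharp g β (e.symm z) := ofCoord_toCoord he hz _
  have h1 : (metricMatrix e g z).mulVec c = fun i => formCoeff e β i z := by
    funext i
    rw [formCoeff, ← inner_sharp g β, ← hX, g.symm, inner_ofCoord]
    simp [Matrix.mulVec, dotProduct, stdVec]
  have h2 : ∀ i, c i = ∑ j, (metricMatrix e g z)⁻¹ i j * formCoeff e β j z := fun i => by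
    have h3 := congrArg ((metricMatrix e g z)⁻¹).mulVec h1
    rw [Matrix.mulVec_mulVec, Matrix.nonsing_inv_mul _ (isUnit_det_metricMatrix he g hz),
      Matrix.one_mulVec] at h3
    exact congrFun h3 i
  rw [normSq, inner_sharp, ← hX, form_ofCoord]
  simp only [h2]

theorem contDiffAt_normSq (he : e ∈ IsManifold.maximalAtlas (𝓡 n) ∞ M) (g : RiemMetric n M)
    (β : OneForm n M) {z : Coord n} (hz : z ∈ e.target) :
    ContDiffAt ℝ ∞ (fun z' => normSq g β (e.symm z')) z := by
  have h : ContDiffAt ℝ ∞ (fun z => ∑ i, formCoeff e β i z *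
      ∑ j, (metricMatrix e g z)⁻¹ i j * formCoeff e β j z) z :=
    ContDiffAt.sum fun i _ => (contDiffAt_formCoeff he β i hz).mul (ContDiffAt.sum fun j _ =>
      (contDiffAt_inv_apply (fun a b => contDiffAt_metricMatrix he g a b hz)
        (isUnit_det_metricMatrix he g hz) i j).mul (contDiffAt_formCoeff he β j hz))
  refine h.congr_of_eventuallyEq ?_
  filter_upwards [e.open_target.mem_nhds hz] with z' hz'
  exact normSq_eq he g β hz'

theorem contDiffAt_energy (he : e ∈ IsManifold.maximalAtlas (𝓡 n) ∞ M) (g : RiemMetric n M)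
    {p : Coord n × Coord n} (hp : p.1 ∈ e.target) :
    ContDiffAt ℝ ∞ (fun q : Coord n × Coord n =>
      g.inner (e.symm q.1) (ofCoord e q.1 q.2) (ofCoord e q.1 q.2)) p := by
  simp only [inner_ofCoord]
  have hc : ∀ i, ContDiffAt ℝ ∞ (fun q : Coord n × Coord n => q.2 i) p := fun i =>
    ((EuclideanSpace.proj (𝕜 := ℝ) i).comp
      (ContinuousLinearMap.snd ℝ (Coord n) (Coord n))).contDiff.contDiffAt
  exact ContDiffAt.sum fun i _ => ContDiffAt.sum fun j _ =>
    (((contDiffAt_metricMatrix he g i j hp).comp p contDiffAt_fst).mul (hc i)).mul (hc j)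

theorem contDiffAt_form (he : e ∈ IsManifold.maximalAtlas (𝓡 n) ∞ M) (β : OneForm n M)
    {p : Coord n × Coord n} (hp : p.1 ∈ e.target) :
    ContDiffAt ℝ ∞ (fun q : Coord n × Coord n => β (e.symm q.1) (ofCoord e q.1 q.2)) p := by
  simp only [form_ofCoord]
  have hc : ∀ i, ContDiffAt ℝ ∞ (fun q : Coord n × Coord n => q.2 i) p := fun i =>
    ((EuclideanSpace.proj (𝕜 := ℝ) i).comp
      (ContinuousLinearMap.snd ℝ (Coord n) (Coord n))).contDiff.contDiffAt
  exact ContDiffAt.sum fun i _ =>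
    ((contDiffAt_formCoeff he β i hp).comp p contDiffAt_fst).mul (hc i)

/-- The `y`-derivative of the energy `g(w, w)` in the direction `v`. -/
theorem fderiv_energy_vertical (he : e ∈ IsManifold.maximalAtlas (𝓡 n) ∞ M) (g : RiemMetric n M)
    {z : Coord n} (hz : z ∈ e.target) (w v : Coord n) :
    fderiv ℝ (fun q : Coord n × Coord n =>
      g.inner (e.symm q.1) (ofCoord e q.1 q.2) (ofCoord e q.1 q.2)) (z, w) (0, v)
      = 2 * g.inner (e.symm z) (ofCoord e z w) (ofCoord e z v) := by
  have h : g.inner (e.symm z) (ofCoord e z v) (ofCoord e z w)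
      = g.inner (e.symm z) (ofCoord e z w) (ofCoord e z v) := g.symm _ _ _
  rw [inner_ofCoord, inner_ofCoord] at h
  simp only [inner_ofCoord]
  rw [fderiv_quadraticForm fun i j =>
    (contDiffAt_metricMatrix he g i j hz).differentiableAt (by simp)]
  simp only [map_zero, zero_mul, Finset.sum_const_zero, zero_add, h]
  ring

theorem fderiv_form_vertical (he : e ∈ IsManifold.maximalAtlas (𝓡 n) ∞ M) (β : OneForm n M)
    {z : Coord n} (hz : z ∈ e.target) (w v : Coord n) :
    fderiv ℝ (fun q : Coord n × Coord n => β (e.symm q.1) (ofCoord e q.1 q.2)) (z, w) (0, v)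
      = β (e.symm z) (ofCoord e z v) := by
  simp only [form_ofCoord]
  rw [fderiv_linearForm fun i => (contDiffAt_formCoeff he β i hz).differentiableAt (by simp)]
  simp

theorem fderiv_energy_horizLift (he : e ∈ IsManifold.maximalAtlas (𝓡 n) ∞ M)
    (g : RiemMetric n M) {p : Coord n × Coord n} (hp : p.1 ∈ e.target) (k : Fin n) :
    fderiv ℝ (fun q : Coord n × Coord n =>
      g.inner (e.symm q.1) (ofCoord e q.1 q.2) (ofCoord e q.1 q.2)) p
      (horizLift (christoffel (metricMatrix e g)) k p) = 0 := by
  simp only [inner_ofCoord]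
  exact fderiv_quadraticForm_horizLift
    (fun i j => (contDiffAt_metricMatrix he g i j hp).differentiableAt (by simp))
    (metricMatrix_symm e g) (isUnit_det_metricMatrix he g hp) k

theorem fderiv_form_horizLift (he : e ∈ IsManifold.maximalAtlas (𝓡 n) ∞ M)
    {g : RiemMetric n M} {β : OneForm n M} (hβ : IsParallel g β) {p : Coord n × Coord n}
    (hp : p.1 ∈ e.target) (k : Fin n) :
    fderiv ℝ (fun q : Coord n × Coord n => β (e.symm q.1) (ofCoord e q.1 q.2)) p
      (horizLift (christoffel (metricMatrix e g)) k p) = 0 := by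
  simp only [form_ofCoord]
  exact fderiv_linearForm_horizLift
    (fun i => (contDiffAt_formCoeff he β i hp).differentiableAt (by simp))
    (fun i j k => christoffel_symm (metricMatrix_symm e g) i j k p.1)
    (fun i j => hβ e he p.1 hp i j) k

/-- A parallel 1-form has constant norm. The function `b² - 2β(w) + g(w, w) = g(w - X, w - X)` is
minimal at `w = X`, so its differential vanishes there, and the terms other than `b²` are
horizontally constant. -/
theorem fderiv_normSq_eq_zero (he : e ∈ IsManifold.maximalAtlas (𝓡 n) ∞ M)
    {g : RiemMetric n M} {β : OneForm n M} (hβ : IsParallel g β) {z : Coord n}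
    (hz : z ∈ e.target) (k : Fin n) :
    fderiv ℝ (fun z' => normSq g β (e.symm z')) z (stdVec k) = 0 := by
  set c := toCoord e (e.symm z) (sharp g β (e.symm z)) with hc
  have hX : ofCoord e z c = sharp g β (e.symm z) := ofCoord_toCoord he hz _
  have hN := ((contDiffAt_normSq he g β hz).differentiableAt (by simp)).hasFDerivAt
  have hA := ((contDiffAt_energy he g (p := (z, c)) hz).differentiableAt (by simp)).hasFDerivAt
  have hB := ((contDiffAt_form he β (p := (z, c)) hz).differentiableAt (by simp)).hasFDerivAt
  have hN' : HasFDerivAt (fun q : Coord n × Coord n => normSq g β (e.symm q.1)) _ (z, c) :=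
    HasFDerivAt.comp (g := fun z' => normSq g β (e.symm z')) (f := Prod.fst) (z, c) hN
      hasFDerivAt_fst
  have hh := (hN'.fun_sub (hB.const_mul 2)).fun_add hA
  have hsq : ∀ (x : M) (v : TangentSpace (𝓡 n) x), normSq g β x - 2 * β x v + g.inner x v v
      = g.inner x (v - sharp g β x) (v - sharp g β x) := fun x v => by
    simp only [map_sub, sub_apply, g.symm x v (sharp g β x), inner_sharp, normSq]
    ring
  have hmin : IsLocalMin (fun q : Coord n × Coord n => normSq g β (e.symm q.1)
      - 2 * β (e.symm q.1) (ofCoord e q.1 q.2)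
      + g.inner (e.symm q.1) (ofCoord e q.1 q.2) (ofCoord e q.1 q.2)) (z, c) := by
    refine Filter.Eventually.of_forall fun q => ?_
    simp only [hsq]
    rw [hX, sub_self, map_zero]
    exact inner_self_nonneg g _ _
  have h0 := DFunLike.congr_fun (hmin.hasFDerivAt_eq_zero hh)
    (horizLift (christoffel (metricMatrix e g)) k (z, c))
  simp only [add_apply, sub_apply, smul_apply, fderiv_energy_horizLift he g (p := (z, c)) hz,
    fderiv_form_horizLift he hβ (p := (z, c)) hz] at h0
  simpa [horizLift] using h0

end ChartExpressions

/-! ### The curvature of `F` for parallel `β` -/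

section FinslerInCharts

variable {n : ℕ} {M : Type*} [TopologicalSpace M] [ChartedSpace (Coord n) M]
  [IsManifold (𝓡 n) ∞ M] {e : OpenPartialHomeomorph M (Coord n)}

namespace IsGeneralAlphaBeta

variable {F : TangentBundle (𝓡 n) M → ℝ} {g : RiemMetric n M} {β : OneForm n M} {b₀ : EReal}
  {φ : ℝ → ℝ → ℝ}

/-- `F²` in coordinates is a smooth function of `g(w, w)`, `β(w)` and `b²`. -/
theorem exists_contDiffAt_coordFn_sq (hF : IsGeneralAlphaBeta F g β b₀ φ)
    (he : e ∈ IsManifold.maximalAtlas (𝓡 n) ∞ M) {p : Coord n × Coord n} (hp : p.1 ∈ e.target)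
    (hp0 : p.2 ≠ 0) :
    ∃ Φ : ℝ × ℝ × ℝ → ℝ,
      ContDiffAt ℝ ∞ Φ (g.inner (e.symm p.1) (ofCoord e p.1 p.2) (ofCoord e p.1 p.2),
        β (e.symm p.1) (ofCoord e p.1 p.2), normSq g β (e.symm p.1)) ∧
      (Function.uncurry fun z w => coordFn e F z w ^ 2) = fun q : Coord n × Coord n =>
        Φ (g.inner (e.symm q.1) (ofCoord e q.1 q.2) (ofCoord e q.1 q.2),
          β (e.symm q.1) (ofCoord e q.1 q.2), normSq g β (e.symm q.1)) := by
  refine ⟨fun r => (√r.1 * φ r.2.2 (r.2.1 / √r.1)) ^ 2, ?_, ?_⟩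
  · have hy : ofCoord e p.1 p.2 ≠ 0 := fun h => hp0 ((ofCoord_eq_zero he hp).1 h)
    have hpos := g.pos _ _ hy
    have hφ := hF.phi_smooth _ (hF.mem_phiDomain _ hy)
    have hr : ContDiffAt ℝ ∞ (fun r : ℝ × ℝ × ℝ => √r.1)
        (g.inner (e.symm p.1) (ofCoord e p.1 p.2) (ofCoord e p.1 p.2),
          β (e.symm p.1) (ofCoord e p.1 p.2), normSq g β (e.symm p.1)) :=
      contDiffAt_fst.sqrt hpos.ne'
    have hb : ContDiffAt ℝ ∞ (fun r : ℝ × ℝ × ℝ => r.2.1 / √r.1)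
        (g.inner (e.symm p.1) (ofCoord e p.1 p.2) (ofCoord e p.1 p.2),
          β (e.symm p.1) (ofCoord e p.1 p.2), normSq g β (e.symm p.1)) :=
      (contDiffAt_fst.comp _ contDiffAt_snd).div hr (Real.sqrt_pos.2 hpos).ne'
    have hc : ContDiffAt ℝ ∞ (fun r : ℝ × ℝ × ℝ => (r.2.2, r.2.1 / √r.1))
        (g.inner (e.symm p.1) (ofCoord e p.1 p.2) (ofCoord e p.1 p.2),
          β (e.symm p.1) (ofCoord e p.1 p.2), normSq g β (e.symm p.1)) :=
      (contDiffAt_snd.comp _ contDiffAt_snd).prodMk hb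
    exact (hr.mul (ContDiffAt.comp (g := fun q : ℝ × ℝ => φ q.1 q.2)
      (f := fun r : ℝ × ℝ × ℝ => (r.2.2, r.2.1 / √r.1)) _ hφ hc)).pow 2
  · funext q
    simp only [Function.uncurry, coordFn, hF.eq, alpha]

theorem contDiffAt_coordFn_sq (hF : IsGeneralAlphaBeta F g β b₀ φ)
    (he : e ∈ IsManifold.maximalAtlas (𝓡 n) ∞ M) {p : Coord n × Coord n} (hp : p.1 ∈ e.target)
    (hp0 : p.2 ≠ 0) :
    ContDiffAt ℝ ∞ (Function.uncurry fun z w => coordFn e F z w ^ 2) p := by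
  obtain ⟨Φ, hΦ, h⟩ := hF.exists_contDiffAt_coordFn_sq he hp hp0
  rw [h]
  exact hΦ.comp p ((contDiffAt_energy he g hp).prodMk ((contDiffAt_form he β hp).prodMk
    ((contDiffAt_normSq he g β hp).comp p contDiffAt_fst)))

/-- For parallel `β` the function `F²` is horizontally constant for the Levi-Civita connection
of `g`, since `g(w, w)`, `β(w)` and `b²` are. -/
theorem fderiv_coordFn_sq_horizLift (hF : IsGeneralAlphaBeta F g β b₀ φ) (hβ : IsParallel g β)
    (he : e ∈ IsManifold.maximalAtlas (𝓡 n) ∞ M) {p : Coord n × Coord n} (hp : p.1 ∈ e.target)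
    (hp0 : p.2 ≠ 0) (k : Fin n) :
    fderiv ℝ (Function.uncurry fun z w => coordFn e F z w ^ 2) p
      (horizLift (christoffel (metricMatrix e g)) k p) = 0 := by
  obtain ⟨Φ, hΦ, h⟩ := hF.exists_contDiffAt_coordFn_sq he hp hp0
  have hA := ((contDiffAt_energy he g hp).differentiableAt (by simp)).hasFDerivAt
  have hB := ((contDiffAt_form he β hp).differentiableAt (by simp)).hasFDerivAt
  have hN : HasFDerivAt (fun q : Coord n × Coord n => normSq g β (e.symm q.1)) _ p :=
    HasFDerivAt.comp (g := fun z' => normSq g β (e.symm z')) (f := Prod.fst) p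
      ((contDiffAt_normSq he g β hp).differentiableAt (by simp)).hasFDerivAt hasFDerivAt_fst
  have hD := HasFDerivAt.comp p (hΦ.differentiableAt (by simp)).hasFDerivAt
    (hA.prodMk (hB.prodMk hN))
  rw [h]
  have h1 := DFunLike.congr_fun hD.fderiv (horizLift (christoffel (metricMatrix e g)) k p)
  refine h1.trans ?_
  rw [ContinuousLinearMap.comp_apply, ContinuousLinearMap.prod_apply,
    ContinuousLinearMap.prod_apply, fderiv_energy_horizLift he g hp,
    fderiv_form_horizLift he hβ hp, ContinuousLinearMap.comp_apply]
  have h2 := fderiv_normSq_eq_zero he hβ hp k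
  simp only [horizLift, ContinuousLinearMap.coe_fst', h2]
  exact map_zero _

/-- The fundamental tensor is half the second `y`-derivative of `F²` in coordinates. -/
theorem fundTensor_ofCoord (hF : IsGeneralAlphaBeta F g β b₀ φ)
    (he : e ∈ IsManifold.maximalAtlas (𝓡 n) ∞ M) {z w : Coord n} (hz : z ∈ e.target)
    (hw : w ≠ 0) (u v : Coord n) :
    fundTensor F (e.symm z) (ofCoord e z w) (ofCoord e z u) (ofCoord e z v)
      = (1 / 2) * fderiv ℝ (fderiv ℝ (Function.uncurry fun z w => coordFn e F z w ^ 2)) (z, w)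
        (0, u) (0, v) := by
  set L := Function.uncurry fun z w => coordFn e F z w ^ 2 with hL
  have hL2 : ContDiffAt ℝ 2 L (z, w) :=
    (hF.contDiffAt_coordFn_sq he (p := (z, w)) hz hw).of_le (WithTop.coe_le_coe.2 le_top)
  have e1 : ∀ s t : ℝ, F ⟨e.symm z, ofCoord e z w + s • ofCoord e z u + t • ofCoord e z v⟩ ^ 2
      = L ((z, w) + s • ((0 : Coord n), u) + t • ((0 : Coord n), v)) := fun s t => by
    simp [hL, coordFn, ofCoord_add, ofCoord_smul]
  have hline : ∀ (q v : Coord n × Coord n), HasDerivAt (fun t : ℝ => q + t • v) v 0 := fun q v => by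
    simpa using ((hasDerivAt_id (0 : ℝ)).smul_const v).const_add q
  have ht : Filter.Tendsto (fun s : ℝ => (z, w) + s • ((0 : Coord n), u)) (nhds 0)
      (nhds (z, w)) := by
    simpa using (hline (z, w) (0, u)).continuousAt.tendsto
  have e2 : ∀ᶠ s in nhds (0 : ℝ), deriv (fun t : ℝ =>
      L ((z, w) + s • ((0 : Coord n), u) + t • ((0 : Coord n), v))) 0
      = fderiv ℝ L ((z, w) + s • ((0 : Coord n), u)) (0, v) := by
    filter_upwards [ht.eventually (eventually_differentiableAt hL2)] with s hs
    have h1 := hs.hasFDerivAt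
    rw [← add_zero ((z, w) + s • ((0 : Coord n), u)), ← zero_smul ℝ ((0 : Coord n), v)] at h1
    have h2 := (HasFDerivAt.comp_hasDerivAt
      (f := fun t : ℝ => (z, w) + s • ((0 : Coord n), u) + t • ((0 : Coord n), v)) 0 h1
      (hline _ _)).deriv
    rw [zero_smul, add_zero] at h2
    exact h2
  unfold fundTensor
  simp only [e1]
  rw [Filter.EventuallyEq.deriv_eq e2]
  have h1 := (differentiableAt_fderiv hL2).hasFDerivAt
  rw [← add_zero (z, w), ← zero_smul ℝ ((0 : Coord n), u)] at h1
  have h2 := (HasFDerivAt.comp_hasDerivAt (f := fun s : ℝ => (z, w) + s • ((0 : Coord n), u)) 0 h1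
    (hline _ _)).clm_apply (hasDerivAt_const (0 : ℝ) ((0 : Coord n), v))
  have h3 := h2.deriv
  simp only [Function.comp, zero_smul, add_zero, map_zero] at h3
  rw [h3]

theorem isUnit_det_hessMatrix (hF : IsGeneralAlphaBeta F g β b₀ φ)
    (he : e ∈ IsManifold.maximalAtlas (𝓡 n) ∞ M) {z w : Coord n} (hz : z ∈ e.target)
    (hw : w ≠ 0) : IsUnit (hessMatrix (coordFn e F) z w).det := by
  have hL2 : ContDiffAt ℝ 2 (Function.uncurry fun z w => coordFn e F z w ^ 2) (z, w) :=
    (hF.contDiffAt_coordFn_sq he (p := (z, w)) hz hw).of_le (WithTop.coe_le_coe.2 le_top)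
  refine isUnit_det_of_forall_pos fun c hc => ?_
  have hne : ∀ v : Coord n, v ≠ 0 → ofCoord e z v ≠ 0 := fun v hv h0 =>
    hv ((ofCoord_eq_zero he hz).1 h0)
  have hpos := hF.finsler.convex (e.symm z) (ofCoord e z w) (ofCoord e z (WithLp.toLp 2 c))
    (hne w hw) (hne _ fun h0 => hc (congrArg WithLp.ofLp h0))
  rw [hF.fundTensor_ofCoord he hz hw] at hpos
  convert! hpos using 1
  set D2 := fderiv ℝ (fderiv ℝ (Function.uncurry fun z w => coordFn e F z w ^ 2)) (z, w) with hD2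
  have hv : ((0 : Coord n), (WithLp.toLp 2 c : Coord n))
      = ∑ i, c i • ((0 : Coord n), (stdVec i : Coord n)) := by
    conv_lhs => rw [coord_eq_sum (WithLp.toLp 2 c : Coord n)]
    ext k <;> simp [Prod.fst_sum, Prod.snd_sum]
  rw [hv]
  simp only [map_sum, map_smul, sum_apply, smul_apply, smul_eq_mul, Finset.mul_sum, hessMatrix,
    Matrix.of_apply, dy_dy_eq_fderiv _ _ hL2, ← hD2]
  rw [Finset.sum_comm]
  refine Finset.sum_congr rfl fun j _ => Finset.sum_congr rfl fun i _ => ?_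
  ring

theorem sprayCoeff_eq (hF : IsGeneralAlphaBeta F g β b₀ φ) (hβ : IsParallel g β)
    (he : e ∈ IsManifold.maximalAtlas (𝓡 n) ∞ M) {z w : Coord n} (hz : z ∈ e.target)
    (hw : w ≠ 0) (i : Fin n) :
    sprayCoeff (coordFn e F) i z w
      = (1 / 2) * ∑ j, ∑ k, christoffel (metricMatrix e g) i j k z * w j * w k := by
  refine sprayCoeff_eq_of_horizontal
    (fun i j k => christoffel_symm (metricMatrix_symm e g) i j k z)
    ((hF.contDiffAt_coordFn_sq he (p := (z, w)) hz hw).of_le (WithTop.coe_le_coe.2 le_top)) ?_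
    (hF.isUnit_det_hessMatrix he hz hw) i
  filter_upwards [(continuous_fst.tendsto (z, w)).eventually (e.open_target.mem_nhds hz),
    (continuous_snd.tendsto (z, w)).eventually (isOpen_ne.mem_nhds hw)] with q hq hq0 k
  exact hF.fderiv_coordFn_sq_horizLift hβ he hq hq0 k

theorem riemannCoeff_eq (hF : IsGeneralAlphaBeta F g β b₀ φ) (hβ : IsParallel g β)
    (he : e ∈ IsManifold.maximalAtlas (𝓡 n) ∞ M) {z w : Coord n} (hz : z ∈ e.target)
    (hw : w ≠ 0) (i k : Fin n) :
    riemannCoeff (coordFn e F) i k z w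
      = ∑ j, ∑ l, curvTensor (metricMatrix e g) i j k l z * w j * w l := by
  refine riemannCoeff_eq_curvTensor ?_ (metricMatrix_symm e g) ?_ i k
  · filter_upwards [e.open_target.mem_nhds hz] with z' hz' i j k
    exact (contDiffAt_christoffel (fun a b => contDiffAt_metricMatrix he g a b hz')
      (isUnit_det_metricMatrix he g hz') i j k).differentiableAt (by simp)
  · filter_upwards [(continuous_fst.tendsto (z, w)).eventually (e.open_target.mem_nhds hz),
      (continuous_snd.tendsto (z, w)).eventually (isOpen_ne.mem_nhds hw)] with q hq hq0 i
    exact hF.sprayCoeff_eq hβ he hq hq0 i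

/-- For parallel `β` the Riemann curvature operator of `F` is that of `g`. -/
theorem finslerCurvOp_eq (hF : IsGeneralAlphaBeta F g β b₀ φ) (hβ : IsParallel g β)
    (he : e ∈ IsManifold.maximalAtlas (𝓡 n) ∞ M) {x : M} (hx : x ∈ e.source)
    {y : TangentSpace (𝓡 n) x} (hy : y ≠ 0) (u : TangentSpace (𝓡 n) x) :
    finslerCurvOp e F x y u = riemCurvOp e g x u y y := by
  have hw : toCoord e x y ≠ 0 := fun h0 => by
    refine hy ((chart_mdifferentiable he).mfderiv_injective hx ?_)
    rw [map_zero]; exact h0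
  unfold finslerCurvOp riemCurvOp
  congr 1
  refine Finset.sum_congr rfl fun i _ => ?_
  congr 1
  simp only [hF.riemannCoeff_eq hβ he (e.map_source hx) hw, Finset.sum_mul]
  rw [Finset.sum_comm]
  refine Finset.sum_congr rfl fun j _ => Finset.sum_congr rfl fun k _ =>
    Finset.sum_congr rfl fun l _ => ?_
  ring

end IsGeneralAlphaBeta

/-- The curvature vector `R(u, y)y` is orthogonal to `y`, and a parallel 1-form vanishes on it. -/
theorem riemCurvOp_orthogonal (he : e ∈ IsManifold.maximalAtlas (𝓡 n) ∞ M)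
    {g : RiemMetric n M} {β : OneForm n M} (hβ : IsParallel g β) {x : M} (hx : x ∈ e.source)
    (y u : TangentSpace (𝓡 n) x) :
    g.inner x y (riemCurvOp e g x u y y) = 0 ∧ β x (riemCurvOp e g x u y y) = 0 := by
  obtain ⟨z, hz, rfl⟩ : ∃ z ∈ e.target, e.symm z = x := ⟨e x, e.map_source hx, e.left_inv hx⟩
  have hΓ : ∀ i j k, DifferentiableAt ℝ (christoffel (metricMatrix e g) i j k) z := fun i j k =>
    (contDiffAt_christoffel (fun a b => contDiffAt_metricMatrix he g a b hz)
      (isUnit_det_metricMatrix he g hz) i j k).differentiableAt (by simp)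
  set w := toCoord e (e.symm z) y with hw
  have hy : ofCoord e z w = y := ofCoord_toCoord he hz y
  have hev : ∀ᶠ q in nhds (z, w), q.1 ∈ e.target :=
    (continuous_fst.tendsto (z, w)).eventually (e.open_target.mem_nhds hz)
  have hR : riemCurvOp e g (e.symm z) u y y
      = ofCoord e z (∑ i, (∑ j, ∑ k, ∑ l, curvTensor (metricMatrix e g) i j k l z * w j *
        toCoord e (e.symm z) u k * w l) • stdVec i) := by
    rw [riemCurvOp, vecOfCoord_symm he hz, e.right_inv hz]
  rw [hR]
  constructor
  · have h := fderiv_curvVector_eq_zero (p := (z, w)) hΓ (metricMatrix_symm e g)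
      ((contDiffAt_energy he g (p := (z, w)) hz).of_le (WithTop.coe_le_coe.2 le_top))
      (hev.mono fun q hq k => fderiv_energy_horizLift he g hq k) (toCoord e (e.symm z) u)
    rw [fderiv_energy_vertical he g hz, hy] at h
    linarith
  · have h := fderiv_curvVector_eq_zero (p := (z, w)) hΓ (metricMatrix_symm e g)
      ((contDiffAt_form he β (p := (z, w)) hz).of_le (WithTop.coe_le_coe.2 le_top))
      (hev.mono fun q hq k => fderiv_form_horizLift he hβ hq k) (toCoord e (e.symm z) u)
    rwa [fderiv_form_vertical he β hz] at h

end FinslerInCharts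

end FinslerGeometry

end

theorem proposition2p2 {n : ℕ} {M : Type*} [TopologicalSpace M]
    [ChartedSpace (FinslerGeometry.Coord n) M] [IsManifold (𝓡 n) ∞ M]
    (g : FinslerGeometry.RiemMetric n M) (β : FinslerGeometry.OneForm n M)
    (b₀ : EReal) (φ : ℝ → ℝ → ℝ) (F : TangentBundle (𝓡 n) M → ℝ)
    (hF : FinslerGeometry.IsGeneralAlphaBeta F g β b₀ φ)
    (hβ : FinslerGeometry.IsParallel g β)
    (e : OpenPartialHomeomorph M (FinslerGeometry.Coord n))
    (he : e ∈ IsManifold.maximalAtlas (𝓡 n) ∞ M) (x : M) (hx : x ∈ e.source)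
    (y u : TangentSpace (𝓡 n) x) (hyu : LinearIndependent ℝ ![y, u])
    (t s : ℝ) (ht : t = FinslerGeometry.normSq g β x)
    (hs : s = β x y / FinslerGeometry.alpha g x y) :
    FinslerGeometry.flagCurvature e F x y u =
        (FinslerGeometry.alpha g x y ^ 2 * FinslerGeometry.alpha g x u ^ 2 - g.inner x y u ^ 2) /
          (F ⟨x, y⟩ ^ 2 * FinslerGeometry.fundTensor F x y u u
            - FinslerGeometry.fundTensor F x y y u ^ 2) *
          (φ t s * (φ t s - s * FinslerGeometry.phi2 φ t s)) *
          FinslerGeometry.sectionalCurvature e g x y u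
      ∧ (g.inner x y y = 1 → g.inner x u u = 1 → g.inner x y u = 0 →
          FinslerGeometry.flagCurvature e F x y u =
            1 / (φ t s ^ 2 * (1 + g.inner x (FinslerGeometry.sharp g β x) u ^ 2 *
              (FinslerGeometry.phi22 φ t s / (φ t s - s * FinslerGeometry.phi2 φ t s)))) *
            FinslerGeometry.sectionalCurvature e g x y u) := by
  have hy : y ≠ 0 := hyu.ne_zero 0
  have hα := FinslerGeometry.alpha_pos g x hy
  obtain ⟨hRy, hRβ⟩ := FinslerGeometry.riemCurvOp_orthogonal he hβ hx y u
  set R := FinslerGeometry.riemCurvOp e g x u y y with hR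
  have hflag : FinslerGeometry.flagCurvature e F x y u
      = φ t s * (φ t s - s * FinslerGeometry.phi2 φ t s) * g.inner x R u /
        (F ⟨x, y⟩ ^ 2 * FinslerGeometry.fundTensor F x y u u
            - FinslerGeometry.fundTensor F x y y u ^ 2) := by
    rw [FinslerGeometry.flagCurvature, hF.finslerCurvOp_eq hβ he hx hy, ← hR,
      hF.fundTensor_self x hy, hF.fundTensor_eq x hy R u ht hs, hRy, hRβ]
    ring
  constructor
  · rw [hflag, FinslerGeometry.sectionalCurvature, ← hR, FinslerGeometry.alpha_sq,
      FinslerGeometry.alpha_sq]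
    have hd := (sub_pos.2 (FinslerGeometry.inner_sq_lt g x hyu)).ne'
    field_simp
  · intro hyy huu hyu0
    have hα1 : FinslerGeometry.alpha g x y = 1 := by rw [FinslerGeometry.alpha, hyy, Real.sqrt_one]
    have hφ : 0 < φ t s := by
      subst ht hs
      exact hF.phi_pos _ (hF.mem_phiDomain x hy)
    have hsβ : β x y = s := by rw [hs, hα1, div_one]
    have hFF : F ⟨x, y⟩ = φ t s := by rw [hF.eq, hα1, one_mul, ht, hs, hα1]
    have hK : FinslerGeometry.sectionalCurvature e g x y u = g.inner x R u := by
      rw [FinslerGeometry.sectionalCurvature, ← hR, hyy, huu, hyu0]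
      simp
    by_cases h0 : φ t s - s * FinslerGeometry.phi2 φ t s = 0
    · -- here the fundamental tensor vanishes on `R`, so `R = 0` by strong convexity
      have hR0 : R = 0 := by
        by_contra hne
        have h1 := hF.finsler.convex x y R hy hne
        rw [hF.fundTensor_eq x hy R R ht hs, hRy, hRβ, h0] at h1
        simp at h1
      rw [hflag, hK, hR0]
      simp
    · have hden : F ⟨x, y⟩ ^ 2 * FinslerGeometry.fundTensor F x y u u
            - FinslerGeometry.fundTensor F x y y u ^ 2
          = φ t s * (φ t s - s * FinslerGeometry.phi2 φ t s) *
            (φ t s ^ 2 * (1 + g.inner x (FinslerGeometry.sharp g β x) u ^ 2 *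
              (FinslerGeometry.phi22 φ t s / (φ t s - s * FinslerGeometry.phi2 φ t s)))) := by
        rw [hFF, hF.fundTensor_eq x hy u u ht hs, hF.fundTensor_eq x hy y u ht hs, hα1, hyy, huu,
          hyu0, hsβ, FinslerGeometry.inner_sharp]
        field_simp
        ring
      rw [hflag, hden, hK, mul_div_mul_left _ _ (mul_ne_zero hφ.ne' h0), one_div_mul_eq_div]
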